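/- Let $d$ be a dimension, let $\beta,\gamma,\gamma'\in\mathbb R$, and let $V,W:\mathbb R^d\to\mathbb R$ be twice differentiable functions with locally bounded Hessians such that $W(-z)=W(z)$ for all $z$, \[ D^2V(x)\ge \beta I,\qquad \gamma I\le D^2W(x)\le \gamma' I\qquad\text{for all } x\in\mathbb R^d, \] and $|\nabla V(x)|=O(e^{a|x|^2})$ as $|x|\to\infty$ for every $a>0$. Let $(\mu_t)_{t\ge 0}$ be a weak solution of the McKean--Vlasov equation \[ \frac{\partial\mu_t}{\partial t}=\Delta\mu_t+\nabla\cdot\bigl(\mu_t\nabla(V+W*\mu_t)\bigr) \] with initial datum $\mu_0$, that is, a narrowly continuous curve of probability measures on $\mathbb R^d$ with $\int_0^T\!\int|x|\,d\mu_s(x)\,ds<\infty$ for all $T$, such that for every $\varphi\in C_c^\infty(\mathbb R^d)$ and every $t\ge0$ \[ \int\varphi\,d\mu_t-\int\varphi\,d\mu_0=\int_0^t\!\int\Bigl(\Delta\varphi-\nabla\varphi\cdot\bigl(\nabla V+\nabla W*\mu_s\bigr)\Bigr)d\mu_s\,ds . \] Write $e(t):=\int|x|^2\,d\mu_t(x)\in[0,\infty]$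 and $M_\alpha(t):=\int e^{\alpha|x|^2}\,d\mu_t(x)\in[0,\infty]$. Let $\overline\eta$ be $\gamma$ if $\gamma<0$, and an arbitrary negative number otherwise, and let \[ a:=2(\beta+\overline\eta),\qquad \overline G:=2d+\frac{|\nabla V(0)|^2}{2|\overline\eta|}. \] Then: (i) for all $t\ge 0$, $\displaystyle e(t)\le e^{-at}\Bigl[e(0)+\overline G\,\frac{e^{at}-1}{a}\Bigr]$, where $\frac{e^{at}-1}{a}$ is read as $t$ if $a=0$; (ii) for any $\alpha_0>0$ there is a continuous positive function $\alpha$ on $[0,\infty)$ with $\alpha(0)=\alpha_0$ such that, if $M_{\alpha_0}(0)<\infty$, then $M_{\alpha(t)}(t)<\infty$ for all $t\ge0$; (iii) if $\beta>0$ and $\beta+\gamma>0$ (the "uniformly convex case"), then $\sup_{t\ge0}e(t)<\infty$ provided $e(0)<\infty$; and if $M_{\alpha_0}(0)<\infty$ for some $\alpha_0>0$, then there is $\alpha>0$ such that $\sup_{t\ge0}M_\alpha(t)<\infty$. -/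

import Mathlib

open MeasureTheory Set Filter
open scoped ContDiff Gradient Laplacian InnerProductSpace

noncomputable section

/-- `V` is twice differentiable on `ℝ^d`, with a locally bounded Hessian. -/
structure HasLocallyBoundedHessian {d : ℕ} (V : EuclideanSpace ℝ (Fin d) → ℝ) : Prop where
  differentiable : Differentiable ℝ V
  differentiable_gradient : Differentiable ℝ (∇ V)
  bounded_on_balls : ∀ R : ℝ, ∃ C : ℝ, ∀ x : EuclideanSpace ℝ (Fin d), ‖x‖ ≤ R →
    ‖fderiv ℝ (∇ V) x‖ ≤ C

/-- The standing assumptions on the confinement potential `V` and the interaction potential `W`: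
`W` is even, both Hessians are locally bounded, `D²V ≥ β I`, `γ I ≤ D²W ≤ γ' I`, and
`|∇V(x)| = O(exp (a |x|²))` at infinity for every `a > 0`. -/
structure AdmissiblePotentials {d : ℕ} (V W : EuclideanSpace ℝ (Fin d) → ℝ)
    (β γ γ' : ℝ) : Prop where
  hessian_V : HasLocallyBoundedHessian V
  hessian_W : HasLocallyBoundedHessian W
  even_W : ∀ z, W (-z) = W z
  le_hessian_V : ∀ x v, β * ‖v‖ ^ 2 ≤ ⟪v, fderiv ℝ (∇ V) x v⟫_ℝ
  le_hessian_W : ∀ x v, γ * ‖v‖ ^ 2 ≤ ⟪v, fderiv ℝ (∇ W) x v⟫_ℝ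
  hessian_W_le : ∀ x v, ⟪v, fderiv ℝ (∇ W) x v⟫_ℝ ≤ γ' * ‖v‖ ^ 2
  growth_V : ∀ a : ℝ, 0 < a →
    (∇ V) =O[Bornology.cobounded (EuclideanSpace ℝ (Fin d))] fun x => Real.exp (a * ‖x‖ ^ 2)

/-- The field `∇W * ν : x ↦ ∫ ∇W(x - y) dν(y)`. -/
def gradConv {d : ℕ} (W : EuclideanSpace ℝ (Fin d) → ℝ)
    (ν : Measure (EuclideanSpace ℝ (Fin d))) (x : EuclideanSpace ℝ (Fin d)) :
    EuclideanSpace ℝ (Fin d) :=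
  ∫ y, (∇ W) (x - y) ∂ν

/-- `(μ_t)_{t ≥ 0}` is a weak (distributional) solution on `[0, ∞) × ℝ^d` of
`∂_t μ_t = Δ μ_t + ∇ · (μ_t ∇(V + W * μ_t))` with initial datum `μ 0`: a narrowly continuous curve
of probability measures, whose first absolute moment is locally integrable in time (so that the
field `∇W * μ_t`, of linear growth, makes sense), and which satisfies the equation when tested
against smooth compactly supported functions. The values of `μ` at negative times play no role. -/
structure IsMcKeanVlasovSolution {d : ℕ} (V W : EuclideanSpace ℝ (Fin d) → ℝ)
    (μ : ℝ → ProbabilityMeasure (EuclideanSpace ℝ (Fin d))) : Prop where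
  continuousOn : ContinuousOn μ (Ici 0)
  first_moment : ∀ T : ℝ,
    ∫⁻ s in Icc 0 T, ∫⁻ x, ‖x‖ₑ ∂(μ s : Measure (EuclideanSpace ℝ (Fin d))) < ⊤
  weak_eq : ∀ φ : EuclideanSpace ℝ (Fin d) → ℝ, ContDiff ℝ ∞ φ → HasCompactSupport φ →
    ∀ t : ℝ, 0 ≤ t →
      ∫ x, φ x ∂(μ t : Measure (EuclideanSpace ℝ (Fin d)))
          - ∫ x, φ x ∂(μ 0 : Measure (EuclideanSpace ℝ (Fin d)))
        = ∫ s in (0 : ℝ)..t, ∫ x, ((Δ φ) x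
            - ⟪(∇ φ) x, (∇ V) x + gradConv W (μ s : Measure (EuclideanSpace ℝ (Fin d))) x⟫_ℝ)
            ∂(μ s : Measure (EuclideanSpace ℝ (Fin d)))

/-- The second moment `∫ |x|² dν(x)`, in `[0, ∞]`. -/
def secondMoment {d : ℕ} (ν : ProbabilityMeasure (EuclideanSpace ℝ (Fin d))) : ENNReal :=
  ∫⁻ x, ENNReal.ofReal (‖x‖ ^ 2) ∂(ν : Measure (EuclideanSpace ℝ (Fin d)))

/-- The square-exponential moment `∫ exp (α |x|²) dν(x)` of order `α`, in `[0, ∞]`. -/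
def sqExpMoment {d : ℕ} (α : ℝ) (ν : ProbabilityMeasure (EuclideanSpace ℝ (Fin d))) : ENNReal :=
  ∫⁻ x, ENNReal.ofReal (Real.exp (α * ‖x‖ ^ 2)) ∂(ν : Measure (EuclideanSpace ℝ (Fin d)))

/-- The quotient `(e^{a t} - 1) / a`, read as its limit `t` when `a = 0`. -/
def expQuotient (a t : ℝ) : ℝ :=
  if a = 0 then t else (Real.exp (a * t) - 1) / a

end

/-! For a radial function f(x) = p(|x|²) with p' = ρ ≥ 0, the time derivative of ∫ f dμ_t is the
μ_t-integral of `radialGenerator`. The drift enters only through -2ρ x·(∇V + ∇W*μ_t), which the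
lower Hessian bounds control from above. As f is not compactly supported, ρ is multiplied by a
nonincreasing cutoff of |x|²; differentiating the cutoff produces a term of the favourable sign,
which is discarded (`lyapunov_truncated`). The cutoff is removed in two ways. `lyapunov_propagation`
treats a generator bounded by A p + f with A, f ≥ 0 and obtains integrability at time t by Fatou.
`lyapunov_dominated` keeps an exponential rate of either sign, but uses dominated convergence and
hence moments already known to be bounded.

This gives a bootstrap. The time-integrated first moment in the definition of a solution controls
the generator of a function comparable to |x|, so the first moment is locally bounded
(`exists_bound_first_moment`). Induction over even moments then gives ∫ |x|^{2k} dμ_t ≤ D k! L(t)^k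
(`pow_moments_bound`). Such factorial growth is equivalent, up to the exponent, to a finite
square-exponential moment, which proves (ii).

For (i), evenness of W symmetrises the interaction into a double integral bounded below by γ times
the variance (`AdmissiblePotentials.integral_inner_gradConv_ge`). Replacing γ by a negative η ≤ γ
leaves a term 2η|∫ x dμ_t|², which absorbs the linear term from ∇V(0); this yields the constant
|∇V(0)|²/(2|η|). For (iii), the rate in (i) can be taken positive, so the second moment, and with it
the first, is bounded for all time. The generator on |x|^{2k} then has a damping term of rate
proportional to k(β+γ), and the same induction closes with an L independent of t
(`pow_moments_uniform_bound`). -/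

/-! ### Hessian bounds: operator norm and monotonicity. -/

section Potentials

variable {E : Type*} [NormedAddCommGroup E] [InnerProductSpace ℝ E]

/-- For a symmetric operator, polarisation and the parallelogram law pass from the quadratic form to
the bilinear form. This makes ∇W Lipschitz. -/
theorem norm_le_of_quadratic_form_bounds {A : E →L[ℝ] E} {γ γ' : ℝ}
    (hsymm : ∀ u v, ⟪u, A v⟫_ℝ = ⟪A u, v⟫_ℝ)
    (hlow : ∀ v, γ * ‖v‖ ^ 2 ≤ ⟪v, A v⟫_ℝ) (hupp : ∀ v, ⟪v, A v⟫_ℝ ≤ γ' * ‖v‖ ^ 2) :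
    ‖A‖ ≤ max |γ| |γ'| := by
  set K := max |γ| |γ'| with hK
  have hK0 : 0 ≤ K := le_max_of_le_left (abs_nonneg _)
  have habs : ∀ v, |⟪v, A v⟫_ℝ| ≤ K * ‖v‖ ^ 2 := by
    intro v
    have h1 : -K ≤ γ := by
      have := neg_abs_le γ; have := le_max_left |γ| |γ'|; linarith
    have h2 : γ' ≤ K := (le_abs_self γ').trans (le_max_right _ _)
    have h3 := sq_nonneg ‖v‖
    rw [abs_le]
    constructor
    · nlinarith [hlow v]
    · nlinarith [hupp v]
  have hpol : ∀ u v, ⟪u, A v⟫_ℝ ≤ K / 2 * (‖u‖ ^ 2 + ‖v‖ ^ 2) := by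
    intro u v
    have h1 := (abs_le.1 (habs (u + v))).2
    have h2 := (abs_le.1 (habs (u - v))).1
    have h3 := parallelogram_law_with_norm ℝ u v
    have h4 : ⟪u + v, A (u + v)⟫_ℝ - ⟪u - v, A (u - v)⟫_ℝ = 4 * ⟪u, A v⟫_ℝ := by
      simp only [map_add, map_sub, inner_add_left, inner_add_right, inner_sub_left,
        inner_sub_right]
      have : ⟪v, A u⟫_ℝ = ⟪u, A v⟫_ℝ := by rw [hsymm, real_inner_comm]
      linarith
    nlinarith
  refine ContinuousLinearMap.opNorm_le_bound _ hK0 fun v => ?_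
  by_cases hA : A v = 0
  · rw [hA, norm_zero]; positivity
  have hAv : 0 < ‖A v‖ := norm_pos_iff.2 hA
  -- The first argument is A v rescaled to the norm of v, so the sum of squares on the right is
  -- 2‖v‖².
  have h := hpol ((‖v‖ / ‖A v‖) • A v) v
  rw [inner_smul_left, real_inner_self_eq_norm_sq, norm_smul] at h
  simp only [conj_trivial, norm_div, norm_norm] at h
  have h1 : ‖v‖ / ‖A v‖ * ‖A v‖ = ‖v‖ := by field_simp
  rw [h1, sq ‖A v‖, ← mul_assoc, h1] at h
  by_cases hv : ‖v‖ = 0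
  · have : v = 0 := norm_eq_zero.1 hv
    simp [this] at hA
  have hv' : 0 < ‖v‖ := lt_of_le_of_ne (norm_nonneg _) (Ne.symm hv)
  nlinarith

/-- Mean value theorem for t ↦ ⟨x - y, g(y + t(x - y))⟩. No continuity of the derivative of g is
needed. -/
theorem inner_sub_map_sub_ge_of_fderiv {g : E → E} (hg : Differentiable ℝ g) {c : ℝ}
    (h : ∀ x v, c * ‖v‖ ^ 2 ≤ ⟪v, fderiv ℝ g x v⟫_ℝ) (x y : E) :
    c * ‖x - y‖ ^ 2 ≤ ⟪x - y, g x - g y⟫_ℝ := by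
  have hder : ∀ t : ℝ, HasDerivAt (fun t : ℝ => ⟪x - y, g (y + t • (x - y))⟫_ℝ)
      ⟪x - y, fderiv ℝ g (y + t • (x - y)) (x - y)⟫_ℝ t := by
    intro t
    have h1 : HasDerivAt (fun t : ℝ => y + t • (x - y)) (x - y) t := by
      simpa using ((hasDerivAt_id t).smul_const (x - y)).const_add y
    have h2 := (hg (y + t • (x - y))).hasFDerivAt.comp_hasDerivAt t h1
    simpa using (hasDerivAt_const t (x - y)).inner ℝ h2
  obtain ⟨t, -, ht⟩ := exists_hasDerivAt_eq_slope _ _ (zero_lt_one' ℝ)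
    (fun t _ => (hder t).continuousAt.continuousWithinAt) (fun t _ => hder t)
  have := h (y + t • (x - y)) (x - y)
  rw [ht] at this
  simpa [inner_sub_right] using this

end Potentials

/-! ### Estimates on ∇V, ∇W and the mean field ∇W * ν. -/

section Admissible

variable {d : ℕ} {V W : EuclideanSpace ℝ (Fin d) → ℝ} {β γ γ' : ℝ}

/-- Symmetry of second derivatives holds at any point of second differentiability, without
continuity of the Hessian; the Riesz isomorphism carries the gradient to the Fréchet derivative. -/
theorem HasLocallyBoundedHessian.symmetric (hW : HasLocallyBoundedHessian W)
    (x u v : EuclideanSpace ℝ (Fin d)) :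
    ⟪u, fderiv ℝ (∇ W) x v⟫_ℝ = ⟪fderiv ℝ (∇ W) x u, v⟫_ℝ := by
  let T := (InnerProductSpace.toDual ℝ (EuclideanSpace ℝ (Fin d))).toContinuousLinearEquiv.toContinuousLinearMap
  have h1 : ∀ y, HasFDerivAt W (fderiv ℝ W y) y := fun y => (hW.differentiable y).hasFDerivAt
  have h2 : HasFDerivAt (fderiv ℝ W) (T.comp (fderiv ℝ (∇ W) x)) x := by
    have h3 := T.hasFDerivAt.comp x (hW.differentiable_gradient x).hasFDerivAt
    have h4 : (T ∘ ∇ W) = fderiv ℝ W := by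
      ext y; simp [T, gradient]
    rwa [h4] at h3
  have h := second_derivative_symmetric h1 h2 u v
  simp [T] at h
  rw [h, real_inner_comm]

theorem gradient_odd_of_even (hW : Differentiable ℝ W) (heven : ∀ z, W (-z) = W z)
    (x : EuclideanSpace ℝ (Fin d)) : (∇ W) (-x) = -(∇ W) x := by
  have h1 : HasFDerivAt (fun z => W (-z)) (-(fderiv ℝ W (-x))) x := by
    have := (hW (-x)).hasFDerivAt.comp x (hasFDerivAt_id x).neg
    have h3 : (fderiv ℝ W (-x)).comp (-ContinuousLinearMap.id ℝ (EuclideanSpace ℝ (Fin d)))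
        = -(fderiv ℝ W (-x)) := by ext v; simp
    rw [h3] at this
    exact this
  have h2 : (fun z => W (-z)) = W := funext heven
  rw [h2] at h1
  simp only [gradient]
  rw [h1.fderiv, map_neg, neg_neg]

namespace AdmissiblePotentials

variable (h : AdmissiblePotentials V W β γ γ')
include h

theorem gradient_W_odd (x) : (∇ W) (-x) = -(∇ W) x :=
  gradient_odd_of_even h.hessian_W.differentiable h.even_W x

theorem gradient_W_zero : (∇ W) 0 = 0 := by
  have := h.gradient_W_odd 0
  rw [neg_zero, eq_neg_iff_add_eq_zero, ← two_smul ℝ] at this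
  exact (smul_eq_zero.1 this).resolve_left two_ne_zero

theorem norm_gradient_W_sub_le (x y) :
    ‖(∇ W) x - (∇ W) y‖ ≤ max |γ| |γ'| * ‖x - y‖ :=
  Convex.norm_image_sub_le_of_norm_fderiv_le (𝕜 := ℝ) (s := univ)
    (fun z _ => h.hessian_W.differentiable_gradient z)
    (fun z _ => norm_le_of_quadratic_form_bounds (h.hessian_W.symmetric z) (h.le_hessian_W z)
      (h.hessian_W_le z)) convex_univ (mem_univ _) (mem_univ _)

theorem norm_gradient_W_le (x) : ‖(∇ W) x‖ ≤ max |γ| |γ'| * ‖x‖ := by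
  simpa [h.gradient_W_zero] using h.norm_gradient_W_sub_le x 0

theorem continuous_gradient_W : Continuous (∇ W) := h.hessian_W.differentiable_gradient.continuous

theorem continuous_gradient_V : Continuous (∇ V) := h.hessian_V.differentiable_gradient.continuous

theorem inner_gradient_W_ge (x y) : γ * ‖x - y‖ ^ 2 ≤ ⟪x - y, (∇ W) x - (∇ W) y⟫_ℝ :=
  inner_sub_map_sub_ge_of_fderiv h.hessian_W.differentiable_gradient h.le_hessian_W x y

theorem inner_gradient_V_ge (x) : β * ‖x‖ ^ 2 + ⟪x, (∇ V) 0⟫_ℝ ≤ ⟪x, (∇ V) x⟫_ℝ := by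
  have := inner_sub_map_sub_ge_of_fderiv h.hessian_V.differentiable_gradient h.le_hessian_V x 0
  simp only [sub_zero, inner_sub_right] at this
  linarith

variable {ν : Measure (EuclideanSpace ℝ (Fin d))} [IsProbabilityMeasure ν]

theorem integrable_gradient_W_sub (hν : Integrable (fun y => ‖y‖) ν) (x) :
    Integrable (fun y => (∇ W) (x - y)) ν := by
  refine Integrable.mono' (g := fun y => max |γ| |γ'| * (‖x‖ + ‖y‖))
    (((integrable_const _).add hν).const_mul _)
    (h.continuous_gradient_W.comp (continuous_const.sub continuous_id)).aestronglyMeasurable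
    (ae_of_all _ fun y => (h.norm_gradient_W_le _).trans ?_)
  exact mul_le_mul_of_nonneg_left (norm_sub_le _ _) (le_max_of_le_left (abs_nonneg _))

theorem norm_gradConv_le (hν : Integrable (fun y => ‖y‖) ν) (x) :
    ‖gradConv W ν x‖ ≤ max |γ| |γ'| * (‖x‖ + ∫ y, ‖y‖ ∂ν) := by
  refine (norm_integral_le_of_norm_le (g := fun y => max |γ| |γ'| * (‖x‖ + ‖y‖))
    (((integrable_const _).add hν).const_mul _)
    (ae_of_all _ fun y => (h.norm_gradient_W_le _).trans ?_)).trans_eq ?_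
  · exact mul_le_mul_of_nonneg_left (norm_sub_le _ _) (le_max_of_le_left (abs_nonneg _))
  · rw [integral_const_mul, integral_add (integrable_const _) hν]
    simp

theorem inner_gradConv_ge (hν : Integrable (fun y => ‖y‖) ν) (x) :
    γ * ‖x‖ ^ 2 - max |γ| |γ'| * ‖x‖ * ∫ y, ‖y‖ ∂ν ≤ ⟪x, gradConv W ν x⟫_ℝ := by
  unfold gradConv
  have hi := h.integrable_gradient_W_sub hν x
  rw [← integral_inner hi]
  have h1 : ∫ y, (γ * ‖x‖ ^ 2 - max |γ| |γ'| * ‖x‖ * ‖y‖) ∂ν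
      = γ * ‖x‖ ^ 2 - max |γ| |γ'| * ‖x‖ * ∫ y, ‖y‖ ∂ν := by
    rw [integral_sub (integrable_const _) (hν.const_mul _)]
    simp only [integral_const, probReal_univ, one_smul]
    exact congrArg _ (integral_const_mul _ _)
  rw [← h1]
  refine integral_mono ((integrable_const _).sub (hν.const_mul _)) (hi.const_inner _) fun y => ?_
  -- Comparing ∇W at x - y and at -y makes the increment exactly x; the leftover ⟨x, ∇W(-y)⟩ is at
  -- most K‖x‖‖y‖ in size.
  have h2 := h.inner_gradient_W_ge (x - y) (-y)
  rw [show x - y - -y = x by abel, inner_sub_right] at h2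
  have h3 : -(max |γ| |γ'| * ‖x‖ * ‖y‖) ≤ ⟪x, (∇ W) (-y)⟫_ℝ := by
    have h4 := (abs_le.1 (abs_real_inner_le_norm x ((∇ W) (-y)))).1
    have h5 := h.norm_gradient_W_le (-y)
    rw [norm_neg] at h5
    nlinarith [norm_nonneg x]
  simp only
  linarith

theorem inner_drift_ge (hν : Integrable (fun y => ‖y‖) ν) (x) :
    (β + γ) * ‖x‖ ^ 2 - ‖x‖ * (‖(∇ V) 0‖ + max |γ| |γ'| * ∫ y, ‖y‖ ∂ν)
      ≤ ⟪x, (∇ V) x + gradConv W ν x⟫_ℝ := by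
  have h1 := h.inner_gradConv_ge hν x
  have h2 := h.inner_gradient_V_ge x
  have h3 := (abs_le.1 (abs_real_inner_le_norm x ((∇ V) 0))).1
  rw [inner_add_right]
  nlinarith

theorem continuous_gradConv (hν : Integrable (fun y => ‖y‖) ν) : Continuous (gradConv W ν) := by
  have hl : LipschitzWith (Real.toNNReal (max |γ| |γ'|)) (gradConv W ν) := by
    refine LipschitzWith.of_dist_le_mul fun x y => ?_
    rw [dist_eq_norm, dist_eq_norm, Real.coe_toNNReal _ (le_max_of_le_left (abs_nonneg _))]
    unfold gradConv
    rw [← integral_sub (h.integrable_gradient_W_sub hν x) (h.integrable_gradient_W_sub hν y)]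
    refine (norm_integral_le_of_norm_le_const (C := max |γ| |γ'| * ‖x - y‖)
      (ae_of_all _ fun z => ?_)).trans_eq (by simp)
    simpa using h.norm_gradient_W_sub_le (x - z) (y - z)
  exact hl.continuous

/-- Symmetrisation of the interaction energy dissipation. -/
theorem integral_inner_gradConv_ge (hν : Integrable (fun y => ‖y‖ ^ 2) ν) :
    γ * (∫ y, ‖y‖ ^ 2 ∂ν - ‖∫ y, y ∂ν‖ ^ 2) ≤ ∫ x, ⟪x, gradConv W ν x⟫_ℝ ∂ν := by
  set K := max |γ| |γ'| with hK
  have hK0 : 0 ≤ K := le_max_of_le_left (abs_nonneg _)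
  have hν1 : Integrable (fun y => ‖y‖) ν := by
    refine Integrable.mono' ((integrable_const 1).add hν) (by fun_prop) (ae_of_all _ fun y => ?_)
    simp only [norm_norm, Pi.add_apply]
    nlinarith [sq_nonneg (‖y‖ - 1)]
  have hid : Integrable (fun y => y) ν := (integrable_norm_iff (by fun_prop)).1 hν1
  have hW := h.continuous_gradient_W
  have hsum : Integrable (fun p : EuclideanSpace ℝ (Fin d) × EuclideanSpace ℝ (Fin d) =>
      ‖p.1‖ ^ 2 + ‖p.2‖ ^ 2) (ν.prod ν) := (hν.comp_fst ν).add (hν.comp_snd ν)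
  have hmeas1 : Continuous fun p : EuclideanSpace ℝ (Fin d) × EuclideanSpace ℝ (Fin d) =>
      ⟪p.1, (∇ W) (p.1 - p.2)⟫_ℝ :=
    continuous_fst.inner (hW.comp (continuous_fst.sub continuous_snd))
  have hmeas2 : Continuous fun p : EuclideanSpace ℝ (Fin d) × EuclideanSpace ℝ (Fin d) =>
      ⟪p.2, (∇ W) (p.1 - p.2)⟫_ℝ :=
    continuous_snd.inner (hW.comp (continuous_fst.sub continuous_snd))
  have hb : ∀ u x y : EuclideanSpace ℝ (Fin d), ‖⟪u, (∇ W) (x - y)⟫_ℝ‖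
      ≤ ‖u‖ * (K * (‖x‖ + ‖y‖)) := fun u x y =>
    (norm_inner_le_norm _ _).trans (mul_le_mul_of_nonneg_left ((h.norm_gradient_W_le _).trans
      (mul_le_mul_of_nonneg_left (norm_sub_le _ _) hK0)) (norm_nonneg _))
  have hi1 : Integrable (fun p : EuclideanSpace ℝ (Fin d) × EuclideanSpace ℝ (Fin d) =>
      ⟪p.1, (∇ W) (p.1 - p.2)⟫_ℝ) (ν.prod ν) := by
    refine Integrable.mono' (hsum.const_mul (2 * K)) hmeas1.aestronglyMeasurable
      (ae_of_all _ fun p => (hb _ _ _).trans ?_)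
    have : ‖p.1‖ * (‖p.1‖ + ‖p.2‖) ≤ 2 * (‖p.1‖ ^ 2 + ‖p.2‖ ^ 2) := by
      nlinarith [sq_nonneg (‖p.1‖ - ‖p.2‖), sq_nonneg ‖p.1‖, sq_nonneg ‖p.2‖]
    nlinarith
  have hi2 : Integrable (fun p : EuclideanSpace ℝ (Fin d) × EuclideanSpace ℝ (Fin d) =>
      ⟪p.2, (∇ W) (p.1 - p.2)⟫_ℝ) (ν.prod ν) := by
    refine Integrable.mono' (hsum.const_mul (2 * K)) hmeas2.aestronglyMeasurable
      (ae_of_all _ fun p => (hb _ _ _).trans ?_)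
    have : ‖p.2‖ * (‖p.1‖ + ‖p.2‖) ≤ 2 * (‖p.1‖ ^ 2 + ‖p.2‖ ^ 2) := by
      nlinarith [sq_nonneg (‖p.1‖ - ‖p.2‖), sq_nonneg ‖p.1‖, sq_nonneg ‖p.2‖]
    nlinarith
  have e1 : ∫ x, ⟪x, gradConv W ν x⟫_ℝ ∂ν
      = ∫ p, ⟪p.1, (∇ W) (p.1 - p.2)⟫_ℝ ∂(ν.prod ν) := by
    rw [integral_prod _ hi1]
    refine integral_congr_ae (ae_of_all _ fun x => ?_)
    exact (integral_inner (h.integrable_gradient_W_sub hν1 x) x).symm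
  -- Exchange the two variables and use that ∇W is odd.
  have e2 : ∫ p, ⟪p.1, (∇ W) (p.1 - p.2)⟫_ℝ ∂(ν.prod ν)
      = - ∫ p, ⟪p.2, (∇ W) (p.1 - p.2)⟫_ℝ ∂(ν.prod ν) := by
    rw [← integral_prod_swap, ← integral_neg]
    refine integral_congr_ae (ae_of_all _ fun p => ?_)
    simp only [Prod.fst_swap, Prod.snd_swap]
    rw [← neg_sub, h.gradient_W_odd, inner_neg_right]
  have e3 : ∫ p, ⟪p.1 - p.2, (∇ W) (p.1 - p.2)⟫_ℝ ∂(ν.prod ν)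
      = 2 * ∫ x, ⟪x, gradConv W ν x⟫_ℝ ∂ν := by
    simp only [inner_sub_left]
    rw [integral_sub hi1 hi2, e1]
    linarith
  have hi3 : Integrable (fun p : EuclideanSpace ℝ (Fin d) × EuclideanSpace ℝ (Fin d) =>
      ⟪p.1, p.2⟫_ℝ) (ν.prod ν) := by
    refine Integrable.mono' hsum (by fun_prop) (ae_of_all _ fun p =>
      (norm_inner_le_norm _ _).trans ?_)
    nlinarith [sq_nonneg (‖p.1‖ - ‖p.2‖), sq_nonneg ‖p.1‖, sq_nonneg ‖p.2‖]
  have e4 : ∫ p, ⟪p.1, p.2⟫_ℝ ∂(ν.prod ν) = ‖∫ y, y ∂ν‖ ^ 2 := by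
    rw [integral_prod _ hi3]
    simp only [integral_inner hid]
    have := integral_inner (𝕜 := ℝ) hid (∫ y, y ∂ν)
    simp only [real_inner_comm] at this ⊢
    rw [this, real_inner_self_eq_norm_sq]
  have e5 : ∫ p, γ * ‖p.1 - p.2‖ ^ 2 ∂(ν.prod ν)
      = 2 * (γ * (∫ y, ‖y‖ ^ 2 ∂ν - ‖∫ y, y ∂ν‖ ^ 2)) := by
    rw [integral_const_mul]
    have : ∀ p : EuclideanSpace ℝ (Fin d) × EuclideanSpace ℝ (Fin d),
        ‖p.1 - p.2‖ ^ 2 = ‖p.1‖ ^ 2 + ‖p.2‖ ^ 2 - 2 * ⟪p.1, p.2⟫_ℝ := fun p => by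
      rw [norm_sub_sq_real]; ring
    simp only [this]
    rw [integral_sub hsum (hi3.const_mul 2), integral_add (hν.comp_fst ν) (hν.comp_snd ν),
      integral_const_mul, e4, integral_fun_fst (fun y : EuclideanSpace ℝ (Fin d) => ‖y‖ ^ 2),
      integral_fun_snd (fun y : EuclideanSpace ℝ (Fin d) => ‖y‖ ^ 2)]
    simp; ring
  have hi4 : Integrable (fun p : EuclideanSpace ℝ (Fin d) × EuclideanSpace ℝ (Fin d) =>
      ⟪p.1 - p.2, (∇ W) (p.1 - p.2)⟫_ℝ) (ν.prod ν) := by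
    simp only [inner_sub_left]; exact hi1.sub hi2
  have hi5 : Integrable (fun p : EuclideanSpace ℝ (Fin d) × EuclideanSpace ℝ (Fin d) =>
      γ * ‖p.1 - p.2‖ ^ 2) (ν.prod ν) := by
    have : ∀ p : EuclideanSpace ℝ (Fin d) × EuclideanSpace ℝ (Fin d),
        ‖p.1 - p.2‖ ^ 2 = ‖p.1‖ ^ 2 + ‖p.2‖ ^ 2 - 2 * ⟪p.1, p.2⟫_ℝ := fun p => by
      rw [norm_sub_sq_real]; ring
    simp only [this]
    exact (hsum.sub (hi3.const_mul 2)).const_mul _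
  have := integral_mono hi5 hi4 fun p => by
    simpa [h.gradient_W_zero] using h.inner_gradient_W_ge (p.1 - p.2) 0
  rw [e5, e3] at this
  linarith

end AdmissiblePotentials

end Admissible

/-! ### Derivatives of functions of |x|². -/

section Radial

variable {d : ℕ}

theorem hasFDerivAt_comp_norm_sq {q q' : ℝ → ℝ} (hq : ∀ s, HasDerivAt q (q' s) s)
    (x : EuclideanSpace ℝ (Fin d)) :
    HasFDerivAt (fun x : EuclideanSpace ℝ (Fin d) => q (‖x‖ ^ 2))
      ((2 * q' (‖x‖ ^ 2)) • innerSL ℝ x) x := by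
  refine ((hq (‖x‖ ^ 2)).comp_hasFDerivAt x
    (hasStrictFDerivAt_norm_sq x).hasFDerivAt).congr_fderiv ?_
  ext v
  simp only [smul_apply, smul_eq_mul, nsmul_eq_mul, innerSL_apply_apply]
  push_cast
  ring

theorem gradient_comp_norm_sq {q q' : ℝ → ℝ} (hq : ∀ s, HasDerivAt q (q' s) s)
    (x : EuclideanSpace ℝ (Fin d)) :
    (∇ fun x : EuclideanSpace ℝ (Fin d) => q (‖x‖ ^ 2)) x = (2 * q' (‖x‖ ^ 2)) • x := by
  have : HasGradientAt (fun x : EuclideanSpace ℝ (Fin d) => q (‖x‖ ^ 2))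
      ((2 * q' (‖x‖ ^ 2)) • x) x := by
    rw [hasGradientAt_iff_hasFDerivAt]
    refine (hasFDerivAt_comp_norm_sq hq x).congr_fderiv ?_
    ext v
    simp
  exact this.gradient

/-- The Hessian is 2q' I + 4q'' x ⊗ x; its trace is taken in an orthonormal basis, where Parseval
sums the rank-one part. -/
theorem laplacian_comp_norm_sq {q q' q'' : ℝ → ℝ} (hq : ∀ s, HasDerivAt q (q' s) s)
    (hq' : ∀ s, HasDerivAt q' (q'' s) s) (x : EuclideanSpace ℝ (Fin d)) :
    (Δ fun x : EuclideanSpace ℝ (Fin d) => q (‖x‖ ^ 2)) x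
      = 2 * d * q' (‖x‖ ^ 2) + 4 * ‖x‖ ^ 2 * q'' (‖x‖ ^ 2) := by
  have h1 : fderiv ℝ (fun x : EuclideanSpace ℝ (Fin d) => q (‖x‖ ^ 2))
      = fun x => (2 * q' (‖x‖ ^ 2)) • innerSL ℝ x :=
    funext fun y => (hasFDerivAt_comp_norm_sq hq y).fderiv
  let J : EuclideanSpace ℝ (Fin d) →L[ℝ] EuclideanSpace ℝ (Fin d) →L[ℝ] ℝ := innerSL ℝ
  have hJ : ∀ u v, J u v = ⟪u, v⟫_ℝ := fun _ _ => rfl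
  have h2 : HasFDerivAt (fun x : EuclideanSpace ℝ (Fin d) => (2 * q' (‖x‖ ^ 2)) • innerSL ℝ x)
      ((2 * q' (‖x‖ ^ 2)) • J
        + ((2 : ℝ) • ((2 * q'' (‖x‖ ^ 2)) • innerSL ℝ x)).smulRight (innerSL ℝ x)) x :=
    ((hasFDerivAt_comp_norm_sq hq' x).const_mul 2).smul
      J.hasFDerivAt
  have h3 := InnerProductSpace.laplacian_eq_iteratedFDeriv_stdOrthonormalBasis
    (fun x : EuclideanSpace ℝ (Fin d) => q (‖x‖ ^ 2))
  rw [h3]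
  simp only [iteratedFDeriv_two_apply, h1, h2.fderiv]
  have h4 : ∀ v : EuclideanSpace ℝ (Fin d), ((2 * q' (‖x‖ ^ 2)) • J
        + ((2 : ℝ) • ((2 * q'' (‖x‖ ^ 2)) • innerSL ℝ x)).smulRight (innerSL ℝ x)) v v
      = 2 * q' (‖x‖ ^ 2) * ‖v‖ ^ 2 + 4 * q'' (‖x‖ ^ 2) * ‖⟪v, x⟫_ℝ‖ ^ 2 := by
    intro v
    simp [hJ, real_inner_comm]
    ring
  simp only [Matrix.cons_val_zero, Matrix.cons_val_one, h4]
  rw [Finset.sum_add_distrib, ← Finset.mul_sum, ← Finset.mul_sum,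
    OrthonormalBasis.sum_sq_norm_inner_right]
  simp
  ring

end Radial

/-! ### Cutoffs and truncated radial test functions. -/

/-- A smooth nonincreasing cutoff, equal to `1` on `(-∞, R]` and to `0` on `[2 R, ∞)`. -/
noncomputable def smoothCutoff (R u : ℝ) : ℝ := Real.smoothTransition (2 - u / R)

namespace smoothCutoff

theorem nonneg (R u : ℝ) : 0 ≤ smoothCutoff R u := Real.smoothTransition.nonneg _

theorem le_one (R u : ℝ) : smoothCutoff R u ≤ 1 := Real.smoothTransition.le_one _

theorem contDiff (R : ℝ) : ContDiff ℝ ∞ (smoothCutoff R) :=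
  Real.smoothTransition.contDiff.comp (contDiff_const.sub (contDiff_id.div_const R))

theorem antitone {R : ℝ} (hR : 0 < R) : Antitone (smoothCutoff R) := fun _ _ h =>
  Real.smoothTransition.monotone (sub_le_sub_left (div_le_div_of_nonneg_right h hR.le) _)

theorem eq_one {R u : ℝ} (hR : 0 < R) (h : u ≤ R) : smoothCutoff R u = 1 :=
  Real.smoothTransition.one_of_one_le (by
    have : u / R ≤ 1 := (div_le_one hR).2 h
    linarith)

theorem eq_zero {R u : ℝ} (hR : 0 < R) (h : 2 * R ≤ u) : smoothCutoff R u = 0 :=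
  Real.smoothTransition.zero_of_nonpos (by
    have : 2 ≤ u / R := (le_div_iff₀ hR).2 h
    linarith)

theorem deriv_nonpos {R : ℝ} (hR : 0 < R) (u : ℝ) : deriv (smoothCutoff R) u ≤ 0 :=
  (antitone hR).deriv_nonpos

end smoothCutoff

/-- The primitive of `ρ` vanishing at `0`, truncated so as to be constant on `[2 R, ∞)`. -/
noncomputable def truncPrimitive (ρ : ℝ → ℝ) (R s : ℝ) : ℝ :=
  ∫ u in (0 : ℝ)..s, ρ u * smoothCutoff R u

namespace truncPrimitive

variable {ρ : ℝ → ℝ}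

theorem hasDerivAt (hρ : ContDiff ℝ ∞ ρ) (R s : ℝ) :
    HasDerivAt (truncPrimitive ρ R) (ρ s * smoothCutoff R s) s := by
  have hc : Continuous fun u => ρ u * smoothCutoff R u :=
    hρ.continuous.mul (smoothCutoff.contDiff R).continuous
  exact intervalIntegral.integral_hasDerivAt_right (hc.intervalIntegrable _ _)
    (hc.stronglyMeasurableAtFilter _ _) hc.continuousAt

theorem contDiff (hρ : ContDiff ℝ ∞ ρ) (R : ℝ) : ContDiff ℝ ∞ (truncPrimitive ρ R) := by
  rw [contDiff_infty_iff_deriv]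
  refine ⟨fun s => (hasDerivAt hρ R s).differentiableAt, ?_⟩
  have : deriv (truncPrimitive ρ R) = fun s => ρ s * smoothCutoff R s :=
    funext fun s => (hasDerivAt hρ R s).deriv
  rw [this]
  exact hρ.mul (smoothCutoff.contDiff R)

theorem intervalIntegrable (hρ : ContDiff ℝ ∞ ρ) (R a b : ℝ) :
    IntervalIntegrable (fun u => ρ u * smoothCutoff R u) volume a b :=
  (hρ.continuous.mul (smoothCutoff.contDiff R).continuous).intervalIntegrable _ _

theorem eq_of_two_mul_le (hρ : ContDiff ℝ ∞ ρ) {R s : ℝ} (hR : 0 < R) (hs : 2 * R ≤ s) :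
    truncPrimitive ρ R s = truncPrimitive ρ R (2 * R) := by
  unfold truncPrimitive
  rw [← intervalIntegral.integral_add_adjacent_intervals
    (intervalIntegrable hρ R 0 (2 * R)) (intervalIntegrable hρ R (2 * R) s), add_eq_left]
  refine intervalIntegral.integral_zero_ae (ae_of_all _ fun u hu => ?_)
  rw [uIoc_of_le hs] at hu
  rw [smoothCutoff.eq_zero hR hu.1.le, mul_zero]

theorem nonneg (h0 : ∀ s, 0 ≤ s → 0 ≤ ρ s) {R s : ℝ} (hs : 0 ≤ s) : 0 ≤ truncPrimitive ρ R s :=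
  intervalIntegral.integral_nonneg hs fun u hu => mul_nonneg (h0 u hu.1) (smoothCutoff.nonneg R u)

theorem le_primitive (hρ : ContDiff ℝ ∞ ρ) (h0 : ∀ s, 0 ≤ s → 0 ≤ ρ s) {R s : ℝ} (hs : 0 ≤ s) :
    truncPrimitive ρ R s ≤ ∫ u in (0 : ℝ)..s, ρ u :=
  intervalIntegral.integral_mono_on hs (intervalIntegrable hρ R 0 s)
    (hρ.continuous.intervalIntegrable _ _) fun u hu =>
      mul_le_of_le_one_right (h0 u hu.1) (smoothCutoff.le_one R u)

/-- The cutoff is nonincreasing, so its value at s is its minimum on [0, s]. Consequently a term χ_R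
A p with A ≥ 0 is absorbed by the truncated quantity itself, before any integrability of p is known.
-/
theorem cutoff_mul_primitive_le (hρ : ContDiff ℝ ∞ ρ) (h0 : ∀ s, 0 ≤ s → 0 ≤ ρ s) {R s : ℝ}
    (hR : 0 < R) (hs : 0 ≤ s) :
    smoothCutoff R s * (∫ u in (0 : ℝ)..s, ρ u) ≤ truncPrimitive ρ R s := by
  rw [← intervalIntegral.integral_const_mul]
  refine intervalIntegral.integral_mono_on hs
    ((hρ.continuous.intervalIntegrable _ _).const_mul _) (intervalIntegrable hρ R 0 s) fun u hu => ?_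
  rw [mul_comm]
  exact mul_le_mul_of_nonneg_left (smoothCutoff.antitone hR hu.2) (h0 u hu.1)

theorem eq_primitive {R s : ℝ} (hR : 0 < R) (hs : s ≤ R) (hs0 : 0 ≤ s) :
    truncPrimitive ρ R s = ∫ u in (0 : ℝ)..s, ρ u := by
  refine intervalIntegral.integral_congr fun u hu => ?_
  rw [uIcc_of_le hs0] at hu
  simp only [smoothCutoff.eq_one hR (hu.2.trans hs), mul_one]

theorem bounded (hρ : ContDiff ℝ ∞ ρ) (h0 : ∀ s, 0 ≤ s → 0 ≤ ρ s) {R s : ℝ} (hR : 0 < R)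
    (hs : 0 ≤ s) : truncPrimitive ρ R s ≤ truncPrimitive ρ R (2 * R) := by
  rcases le_total (2 * R) s with h | h
  · exact (eq_of_two_mul_le hρ hR h).le
  · unfold truncPrimitive
    rw [← intervalIntegral.integral_add_adjacent_intervals
      (intervalIntegrable hρ R 0 s) (intervalIntegrable hρ R s (2 * R))]
    have : 0 ≤ ∫ u in s..(2 * R), ρ u * smoothCutoff R u :=
      intervalIntegral.integral_nonneg h fun u hu =>
        mul_nonneg (h0 u (hs.trans hu.1)) (smoothCutoff.nonneg R u)
    linarith

end truncPrimitive

/-! ### Measurability in time along a narrowly continuous curve. -/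

section Curves

variable {d : ℕ}

/-- By the portmanteau theorem the mass of an open set is lower semicontinuous in the measure, and
the open sets are a generating π-system. -/
theorem ProbabilityMeasure.measurable_of_continuous {X T : Type*} [TopologicalSpace X]
    [MeasurableSpace X] [BorelSpace X] [HasOuterApproxClosed X] [TopologicalSpace T]
    [MeasurableSpace T] [OpensMeasurableSpace T] {μ : T → ProbabilityMeasure X}
    (hμ : Continuous μ) : Measurable fun s => (μ s : Measure X) := by
  refine Measurable.measure_of_isPiSystem_of_isProbabilityMeasure
    (BorelSpace.measurable_eq (α := X)) isPiSystem_isOpen fun U hU => ?_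
  refine LowerSemicontinuous.measurable fun s => ?_
  exact lowerSemicontinuousAt_iff_le_liminf.2
    (ProbabilityMeasure.le_liminf_measure_open_of_tendsto hμ.continuousAt hU)

/-- The kernel `s ↦ μ_{s⁺}` of a narrowly continuous curve on `[0, ∞)`. -/
noncomputable def curveKernel (μ : ℝ → ProbabilityMeasure (EuclideanSpace ℝ (Fin d)))
    (hμ : ContinuousOn μ (Ici 0)) : ProbabilityTheory.Kernel ℝ (EuclideanSpace ℝ (Fin d)) where
  toFun s := (μ (max s 0) : Measure (EuclideanSpace ℝ (Fin d)))
  measurable' := ProbabilityMeasure.measurable_of_continuous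
    (hμ.comp_continuous (continuous_id.max continuous_const) fun _ =>
      mem_Ici.2 (le_max_right _ _))

theorem curveKernel_apply {μ : ℝ → ProbabilityMeasure (EuclideanSpace ℝ (Fin d))}
    (hμ : ContinuousOn μ (Ici 0)) {s : ℝ} (hs : 0 ≤ s) :
    curveKernel μ hμ s = (μ s : Measure (EuclideanSpace ℝ (Fin d))) := by
  change ((μ (max s 0) : Measure (EuclideanSpace ℝ (Fin d)))) = _
  rw [max_eq_left hs]

instance {μ : ℝ → ProbabilityMeasure (EuclideanSpace ℝ (Fin d))} (hμ : ContinuousOn μ (Ici 0)) :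
    ProbabilityTheory.IsMarkovKernel (curveKernel μ hμ) :=
  ⟨fun s => inferInstanceAs
    (IsProbabilityMeasure (μ (max s 0) : Measure (EuclideanSpace ℝ (Fin d))))⟩

theorem aestronglyMeasurable_integral_curve
    {μ : ℝ → ProbabilityMeasure (EuclideanSpace ℝ (Fin d))} (hμ : ContinuousOn μ (Ici 0))
    {F : ℝ → EuclideanSpace ℝ (Fin d) → ℝ}
    (hF : StronglyMeasurable (Function.uncurry fun s x => F (max s 0) x)) (t : ℝ) :
    AEStronglyMeasurable (fun s => ∫ x, F s x ∂(μ s : Measure (EuclideanSpace ℝ (Fin d))))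
      (volume.restrict (Ioc 0 t)) := by
  refine AEStronglyMeasurable.congr
    (StronglyMeasurable.integral_kernel_prod_right (κ := curveKernel μ hμ) hF).aestronglyMeasurable
    ?_
  filter_upwards [ae_restrict_mem measurableSet_Ioc] with s hs
  rw [curveKernel_apply hμ hs.1.le, max_eq_left hs.1.le]

theorem stronglyMeasurable_gradConv_curve {W : EuclideanSpace ℝ (Fin d) → ℝ}
    (hW : Continuous (∇ W)) {μ : ℝ → ProbabilityMeasure (EuclideanSpace ℝ (Fin d))}
    (hμ : ContinuousOn μ (Ici 0)) :
    StronglyMeasurable (Function.uncurry fun s x =>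
      gradConv W (μ (max s 0) : Measure (EuclideanSpace ℝ (Fin d))) x) := by
  have h1 : StronglyMeasurable (Function.uncurry
      fun (p : ℝ × EuclideanSpace ℝ (Fin d)) (y : EuclideanSpace ℝ (Fin d)) =>
        (∇ W) (p.2 - y)) := by
    refine Continuous.stronglyMeasurable (hW.comp ?_)
    fun_prop
  have h2 := StronglyMeasurable.integral_kernel_prod_right
    (κ := (curveKernel μ hμ).comap Prod.fst measurable_fst) h1
  exact h2

theorem continuousOn_integral_curve {μ : ℝ → ProbabilityMeasure (EuclideanSpace ℝ (Fin d))}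
    (hμ : ContinuousOn μ (Ici 0)) {f : EuclideanSpace ℝ (Fin d) → ℝ} (hf : Continuous f)
    {C : ℝ} (hC : ∀ x, |f x| ≤ C) :
    ContinuousOn (fun s => ∫ x, f x ∂(μ s : Measure (EuclideanSpace ℝ (Fin d)))) (Ici 0) := by
  intro s hs
  have := (ProbabilityMeasure.tendsto_iff_forall_integral_tendsto.1 (hμ s hs))
    (BoundedContinuousFunction.ofNormedAddCommGroup f hf C hC)
  exact this

end Curves

/-- The weak equation only says that ψ is the primitive of an integrable function, so this is the
product rule for absolutely continuous functions. It is applied to Φ, which agrees with ψ on [0, t].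
-/
theorem exp_mul_sub_eq_integral {ψ g : ℝ → ℝ} {t lam : ℝ} (ht : 0 ≤ t)
    (hg : IntervalIntegrable g volume 0 t)
    (hψ : ∀ s ∈ Icc 0 t, ψ s - ψ 0 = ∫ u in (0 : ℝ)..s, g u) :
    Real.exp (lam * t) * ψ t - ψ 0
      = ∫ s in (0 : ℝ)..t, Real.exp (lam * s) * (lam * ψ s + g s) := by
  set Φ : ℝ → ℝ := fun s => ψ 0 + ∫ u in (0 : ℝ)..s, g u with hΦ
  have hΦψ : ∀ s ∈ Icc 0 t, Φ s = ψ s := fun s hs => by rw [hΦ]; simp only; rw [← hψ s hs]; ring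
  have h1 : AbsolutelyContinuousOnInterval (fun s => Real.exp (lam * s)) 0 t :=
    ContDiffOn.absolutelyContinuousOnInterval (by fun_prop)
  have h2 : AbsolutelyContinuousOnInterval (fun s => ∫ u in (0 : ℝ)..s, g u) 0 t :=
    hg.absolutelyContinuousOnInterval_intervalIntegral (by simp)
  have hc : AbsolutelyContinuousOnInterval (fun _ : ℝ => ψ 0) 0 t :=
    ContDiffOn.absolutelyContinuousOnInterval (by fun_prop)
  have h3 : AbsolutelyContinuousOnInterval Φ 0 t := hc.add h2
  have h4 := h1.integral_deriv_mul_eq_sub h3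
  rw [hΦψ t ⟨ht, le_rfl⟩, hΦψ 0 ⟨le_rfl, ht⟩] at h4
  simp only [mul_zero, Real.exp_zero, one_mul] at h4
  rw [← h4]
  refine intervalIntegral.integral_congr_ae ?_
  have h5 := hg.ae_hasDerivAt_integral
  filter_upwards [h5] with s hs hs'
  rw [uIoc_of_le ht] at hs'
  have hsI : s ∈ Icc 0 t := ⟨hs'.1.le, hs'.2⟩
  have h6 : HasDerivAt Φ (g s) s := (hs (by rw [uIcc_of_le ht]; exact hsI) 0 (by simp)).const_add _
  have h7 : HasDerivAt (fun s => Real.exp (lam * s)) (Real.exp (lam * s) * lam) s := by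
    simpa using ((hasDerivAt_id s).const_mul lam).exp
  rw [h6.deriv, h7.deriv, hΦψ s hsI]
  ring

/-! ### Lyapunov inequality for truncated test functions. -/

section Lyapunov

variable {d : ℕ}

/-- The generator `f ↦ Δ f - ∇ f · (∇ V + ∇ W * ν)`, applied to `f(x) = p(|x|²)` with `p' = ρ`. -/
noncomputable def radialGenerator (V W : EuclideanSpace ℝ (Fin d) → ℝ) (ρ : ℝ → ℝ)
    (ν : Measure (EuclideanSpace ℝ (Fin d))) (x : EuclideanSpace ℝ (Fin d)) : ℝ :=
  ρ (‖x‖ ^ 2) * (2 * d - 2 * ⟪x, (∇ V) x + gradConv W ν x⟫_ℝ)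
    + 4 * ‖x‖ ^ 2 * deriv ρ (‖x‖ ^ 2)

variable {V W : EuclideanSpace ℝ (Fin d) → ℝ} {β γ γ' : ℝ}
  {μ : ℝ → ProbabilityMeasure (EuclideanSpace ℝ (Fin d))}

theorem integrable_iff_lintegral_lt_top {X : Type*} [MeasurableSpace X] {ν : Measure X} {f : X → ℝ}
    (hf : AEStronglyMeasurable f ν) (h0 : ∀ x, 0 ≤ f x) :
    Integrable f ν ↔ ∫⁻ x, ENNReal.ofReal (f x) ∂ν < ⊤ := by
  rw [Integrable, and_iff_right hf, hasFiniteIntegral_iff_ofReal (ae_of_all _ h0)]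

namespace IsMcKeanVlasovSolution

variable (hμ : IsMcKeanVlasovSolution V W μ)
include hμ

theorem aemeasurable_lintegral_norm (t : ℝ) :
    AEMeasurable (fun s => ∫⁻ x, ‖x‖ₑ ∂(μ s : Measure (EuclideanSpace ℝ (Fin d))))
      (volume.restrict (Ioc 0 t)) := by
  have h1 : Measurable fun s => ∫⁻ x, ‖x‖ₑ ∂(curveKernel μ hμ.continuousOn s) :=
    Measurable.lintegral_kernel (κ := curveKernel μ hμ.continuousOn) measurable_enorm
  refine h1.aemeasurable.congr ?_
  filter_upwards [ae_restrict_mem measurableSet_Ioc] with s hs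
  rw [curveKernel_apply hμ.continuousOn hs.1.le]

theorem lintegral_lintegral_norm_ne_top (t : ℝ) :
    ∫⁻ s in Ioc 0 t, ∫⁻ x, ‖x‖ₑ ∂(μ s : Measure (EuclideanSpace ℝ (Fin d))) ≠ ⊤ :=
  ((lintegral_mono_set Ioc_subset_Icc_self).trans_lt (hμ.first_moment t)).ne

theorem ae_integrable_norm (t : ℝ) :
    ∀ᵐ s ∂volume.restrict (Ioc 0 t),
      Integrable (fun x => ‖x‖) (μ s : Measure (EuclideanSpace ℝ (Fin d))) := by
  filter_upwards [ae_lt_top' (hμ.aemeasurable_lintegral_norm t)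
    (hμ.lintegral_lintegral_norm_ne_top t)] with s hs
  refine ⟨by fun_prop, ?_⟩
  simpa [HasFiniteIntegral] using hs

theorem intervalIntegrable_integral_norm {t : ℝ} (ht : 0 ≤ t) :
    IntervalIntegrable (fun s => ∫ x, ‖x‖ ∂(μ s : Measure (EuclideanSpace ℝ (Fin d))))
      volume 0 t := by
  rw [intervalIntegrable_iff, uIoc_of_le ht]
  refine (integrable_toReal_of_lintegral_ne_top (hμ.aemeasurable_lintegral_norm t)
    (hμ.lintegral_lintegral_norm_ne_top t)).congr (ae_of_all _ fun s => ?_)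
  exact (integral_norm_eq_lintegral_enorm (by fun_prop)).symm

end IsMcKeanVlasovSolution

variable (hVW : AdmissiblePotentials V W β γ γ') (hμ : IsMcKeanVlasovSolution V W μ)
include hVW hμ

/-- Everything on the left is bounded, so the inequality needs only an integrable majorant of the
truncated generator at almost every time. The factor e^{lam t} is built in so that decay rates are
not lost. -/
theorem lyapunov_truncated {ρ : ℝ → ℝ} (hρ : ContDiff ℝ ∞ ρ) (h0 : ∀ s, 0 ≤ s → 0 ≤ ρ s)
    {R t lam : ℝ} (hR : 0 < R) (ht : 0 ≤ t) {H : ℝ → ℝ} (hH : IntervalIntegrable H volume 0 t)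
    (hle : ∀ᵐ s ∂volume.restrict (Ioc 0 t),
      Integrable (fun x => ‖x‖) (μ s : Measure (EuclideanSpace ℝ (Fin d))) →
      ∃ B : EuclideanSpace ℝ (Fin d) → ℝ,
        Integrable B (μ s : Measure (EuclideanSpace ℝ (Fin d))) ∧
        (∀ x, lam * truncPrimitive ρ R (‖x‖ ^ 2) + smoothCutoff R (‖x‖ ^ 2) *
          radialGenerator V W ρ (μ s : Measure (EuclideanSpace ℝ (Fin d))) x ≤ B x) ∧
        ∫ x, B x ∂(μ s : Measure (EuclideanSpace ℝ (Fin d))) ≤ H s) :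
    Real.exp (lam * t) *
        ∫ x, truncPrimitive ρ R (‖x‖ ^ 2) ∂(μ t : Measure (EuclideanSpace ℝ (Fin d)))
      ≤ ∫ x, truncPrimitive ρ R (‖x‖ ^ 2) ∂(μ 0 : Measure (EuclideanSpace ℝ (Fin d)))
        + ∫ s in (0 : ℝ)..t, Real.exp (lam * s) * H s := by
  set q : ℝ → ℝ := truncPrimitive ρ R with hq
  set c : ℝ := q (2 * R) with hc
  set q' : ℝ → ℝ := fun s => ρ s * smoothCutoff R s with hq'
  set q'' : ℝ → ℝ := fun s => deriv ρ s * smoothCutoff R s + ρ s * deriv (smoothCutoff R) s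
    with hq''
  have hρd : Differentiable ℝ ρ := hρ.differentiable (by simp)
  have hρ' : Continuous (deriv ρ) := hρ.continuous_deriv (by simp)
  have hχd : Differentiable ℝ (smoothCutoff R) := (smoothCutoff.contDiff R).differentiable (by simp)
  have hχ' : Continuous (deriv (smoothCutoff R)) :=
    (smoothCutoff.contDiff R).continuous_deriv (by simp)
  have hqc : Continuous q := (truncPrimitive.contDiff hρ R).continuous
  have hq'c : Continuous q' := hρ.continuous.mul (smoothCutoff.contDiff R).continuous
  have hq''c : Continuous q'' :=
    (hρ'.mul (smoothCutoff.contDiff R).continuous).add (hρ.continuous.mul hχ')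
  have hd1 : ∀ s, HasDerivAt (fun s => q s - c) (q' s) s := fun s =>
    (truncPrimitive.hasDerivAt hρ R s).sub_const c
  have hd2 : ∀ s, HasDerivAt q' (q'' s) s := fun s =>
    (hρd s).hasDerivAt.mul (hχd s).hasDerivAt
  -- Subtracting the terminal value c gives compact support; the constant cancels because all μ_t
  -- have mass one.
  set φ : EuclideanSpace ℝ (Fin d) → ℝ := fun x => q (‖x‖ ^ 2) - c with hφ
  have hφs : ContDiff ℝ ∞ φ :=
    ((truncPrimitive.contDiff hρ R).comp (contDiff_norm_sq ℝ)).sub contDiff_const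
  have hcomp : ∀ {F : Type} [Zero F] {f : EuclideanSpace ℝ (Fin d) → F},
      (∀ x, 2 * R < ‖x‖ ^ 2 → f x = 0) → HasCompactSupport f := by
    intro F _ f hf
    refine HasCompactSupport.intro (isCompact_closedBall 0 (2 * R + 1)) fun x hx => hf x ?_
    rw [mem_closedBall_zero_iff, not_le] at hx
    nlinarith
  have hφc : HasCompactSupport φ := hcomp fun x hx => by
    rw [hφ]
    simp only [hc, hq, truncPrimitive.eq_of_two_mul_le hρ hR hx.le, sub_self]
  have hq'0 : ∀ s, 2 * R < s → q' s = 0 := fun s hs => by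
    simp only [hq', smoothCutoff.eq_zero hR hs.le, mul_zero]
  have hq''0 : ∀ s, 2 * R < s → q'' s = 0 := fun s hs => by
    have : deriv (smoothCutoff R) s = 0 := by
      have : smoothCutoff R =ᶠ[nhds s] fun _ => 0 := by
        filter_upwards [Ioi_mem_nhds hs] with u hu
        exact smoothCutoff.eq_zero hR (le_of_lt hu)
      rw [this.deriv_eq, deriv_const]
    simp only [hq'', this, smoothCutoff.eq_zero hR hs.le, mul_zero, add_zero]
  set ν : ℝ → Measure (EuclideanSpace ℝ (Fin d)) :=
    fun s => (μ s : Measure (EuclideanSpace ℝ (Fin d))) with hν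
  set a : EuclideanSpace ℝ (Fin d) → ℝ := fun x =>
    2 * d * q' (‖x‖ ^ 2) + 4 * ‖x‖ ^ 2 * q'' (‖x‖ ^ 2) - 2 * q' (‖x‖ ^ 2) * ⟪x, (∇ V) x⟫_ℝ with ha
  have hVc := hVW.continuous_gradient_V
  have hac : Continuous a := by
    have := continuous_id.inner (𝕜 := ℝ) hVc
    simp only [id] at this
    fun_prop
  obtain ⟨Ca, hCa⟩ := hac.bounded_above_of_compact_support (hcomp fun x hx => by
    simp only [ha, hq'0 _ hx, hq''0 _ hx]; ring)
  -- The function b absorbs the linear growth of ∇W*μ_s on the support of q', so the generator is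
  -- bounded by an affine function of the first moment at time s, which is integrable in time.
  set b : EuclideanSpace ℝ (Fin d) → ℝ := fun x => 2 * q' (‖x‖ ^ 2) * ‖x‖ * (‖x‖ + 1) with hb
  obtain ⟨Cb, hCb⟩ := (show Continuous b by fun_prop).bounded_above_of_compact_support
    (hcomp fun x hx => by simp only [hb, hq'0 _ hx]; ring)
  have hCb0 : 0 ≤ Cb := (norm_nonneg _).trans (hCb 0)
  set L : ℝ → EuclideanSpace ℝ (Fin d) → ℝ := fun s x =>
    a x - 2 * q' (‖x‖ ^ 2) * ⟪x, gradConv W (ν s) x⟫_ℝ with hL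
  have hLeq : ∀ s x, (Δ φ) x - ⟪(∇ φ) x, (∇ V) x + gradConv W (ν s) x⟫_ℝ = L s x := by
    intro s x
    rw [laplacian_comp_norm_sq hd1 hd2, gradient_comp_norm_sq hd1, real_inner_smul_left,
      inner_add_right]
    simp only [hL, ha]
    ring
  set K := max |γ| |γ'| with hK
  have hK0 : 0 ≤ K := le_max_of_le_left (abs_nonneg _)
  set m : ℝ → ℝ := fun s => ∫ x, ‖x‖ ∂(ν s) with hm
  have hm0 : ∀ s, 0 ≤ m s := fun s => integral_nonneg fun x => norm_nonneg x
  have hLbound : ∀ s, Integrable (fun x => ‖x‖) (ν s) → ∀ x, ‖L s x‖ ≤ Ca + K * Cb * (1 + m s) := by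
    intro s hs x
    refine (norm_sub_le _ _).trans (add_le_add (hCa x) ?_)
    have h1 : ‖⟪x, gradConv W (ν s) x⟫_ℝ‖ ≤ ‖x‖ * (K * (‖x‖ + m s)) :=
      (norm_inner_le_norm _ _).trans
        (mul_le_mul_of_nonneg_left (hVW.norm_gradConv_le hs x) (norm_nonneg _))
    have h2 : 0 ≤ q' (‖x‖ ^ 2) := mul_nonneg (h0 _ (sq_nonneg _)) (smoothCutoff.nonneg _ _)
    have h3 := hCb x
    rw [Real.norm_of_nonneg (by positivity)] at h3
    rw [norm_mul, Real.norm_of_nonneg (by positivity)]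
    calc 2 * q' (‖x‖ ^ 2) * ‖⟪x, gradConv W (ν s) x⟫_ℝ‖
        ≤ 2 * q' (‖x‖ ^ 2) * (‖x‖ * (K * (‖x‖ + m s))) := by gcongr
      _ ≤ 2 * q' (‖x‖ ^ 2) * (‖x‖ * (K * ((‖x‖ + 1) * (1 + m s)))) := by
          gcongr
          nlinarith [norm_nonneg x, hm0 s, mul_nonneg (norm_nonneg x) (hm0 s)]
      _ = K * b x * (1 + m s) := by rw [hb]; ring
      _ ≤ K * Cb * (1 + m s) := by
          have := hm0 s
          gcongr
  have hLint : ∀ s, Integrable (fun x => ‖x‖) (ν s) → Integrable (L s) (ν s) := by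
    intro s hs
    refine Integrable.mono' (integrable_const (Ca + K * Cb * (1 + m s))) ?_
      (ae_of_all _ (hLbound s hs))
    have h1 := hVW.continuous_gradConv hs
    have h2 := continuous_id.inner (𝕜 := ℝ) h1
    simp only [id] at h2
    exact (show Continuous (L s) by fun_prop).aestronglyMeasurable
  set g : ℝ → ℝ := fun s => ∫ x, L s x ∂(ν s) with hg
  have hgm : AEStronglyMeasurable g (volume.restrict (Ioc 0 t)) := by
    refine aestronglyMeasurable_integral_curve hμ.continuousOn ?_ t
    have h1 := stronglyMeasurable_gradConv_curve hVW.continuous_gradient_W hμ.continuousOn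
    have h2 : StronglyMeasurable fun p : ℝ × EuclideanSpace ℝ (Fin d) => p.2 :=
      continuous_snd.stronglyMeasurable
    have h3 := h2.inner (𝕜 := ℝ) h1
    have h4 : StronglyMeasurable fun p : ℝ × EuclideanSpace ℝ (Fin d) => a p.2 :=
      (hac.comp continuous_snd).stronglyMeasurable
    have h5 : StronglyMeasurable fun p : ℝ × EuclideanSpace ℝ (Fin d) => 2 * q' (‖p.2‖ ^ 2) :=
      Continuous.stronglyMeasurable (by fun_prop)
    exact h4.sub (h5.mul h3)
  have hgi : IntervalIntegrable g volume 0 t := by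
    have h1 : IntervalIntegrable (fun s => Ca + K * Cb * (1 + m s)) volume 0 t :=
      intervalIntegrable_const.add ((intervalIntegrable_const.add
        (hμ.intervalIntegrable_integral_norm ht)).const_mul _)
    rw [intervalIntegrable_iff, uIoc_of_le ht] at h1 ⊢
    refine Integrable.mono' h1 hgm ?_
    filter_upwards [hμ.ae_integrable_norm t] with s hs
    refine (norm_integral_le_of_norm_le_const (ae_of_all _ (hLbound s hs))).trans_eq ?_
    simp [hν]
  have hqb : ∀ x : EuclideanSpace ℝ (Fin d), |q (‖x‖ ^ 2)| ≤ c := fun x => by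
    rw [abs_of_nonneg (truncPrimitive.nonneg h0 (sq_nonneg _))]
    exact truncPrimitive.bounded hρ h0 hR (sq_nonneg _)
  have hqx : Continuous fun x : EuclideanSpace ℝ (Fin d) => q (‖x‖ ^ 2) := by fun_prop
  have hqi : ∀ s, Integrable (fun x : EuclideanSpace ℝ (Fin d) => q (‖x‖ ^ 2)) (ν s) := fun s =>
    Integrable.mono' (integrable_const c) hqx.aestronglyMeasurable (ae_of_all _ hqb)
  set ψ : ℝ → ℝ := fun s => ∫ x, q (‖x‖ ^ 2) ∂(ν s) with hψ
  have hψφ : ∀ s, ∫ x, φ x ∂(ν s) = ψ s - c := fun s => by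
    rw [hφ, integral_sub (hqi s) (integrable_const _)]
    simp [hν, hψ]
  have hweak : ∀ s ∈ Icc 0 t, ψ s - ψ 0 = ∫ u in (0 : ℝ)..s, g u := by
    intro s hs
    have h1 := hμ.weak_eq φ hφs hφc s hs.1
    have h2 : ∫ x, φ x ∂(ν s) - ∫ x, φ x ∂(ν 0) = ∫ u in (0 : ℝ)..s, g u := by
      rw [h1]
      refine intervalIntegral.integral_congr fun u _ => ?_
      exact integral_congr_ae (ae_of_all _ fun x => hLeq u x)
    rw [hψφ, hψφ] at h2
    linarith
  have hmain := exp_mul_sub_eq_integral (lam := lam) ht hgi hweak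
  have hψc : ContinuousOn ψ (Icc 0 t) :=
    (continuousOn_integral_curve hμ.continuousOn hqx hqb).mono Icc_subset_Ici_self
  have hψi : IntervalIntegrable ψ volume 0 t :=
    ContinuousOn.intervalIntegrable (by rwa [uIcc_of_le ht])
  have hfin : ∫ s in (0 : ℝ)..t, Real.exp (lam * s) * (lam * ψ s + g s)
      ≤ ∫ s in (0 : ℝ)..t, Real.exp (lam * s) * H s := by
    have hec : ContinuousOn (fun s => Real.exp (lam * s)) (uIcc 0 t) := by fun_prop
    refine intervalIntegral.integral_mono_ae_restrict ht
      (((hψi.const_mul lam).add hgi).continuousOn_mul hec) (hH.continuousOn_mul hec) ?_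
    rw [restrict_Ioc_eq_restrict_Icc.symm]
    filter_upwards [hμ.ae_integrable_norm t, hle] with s hs hs'
    obtain ⟨B, hBi, hBle, hBH⟩ := hs' hs
    refine mul_le_mul_of_nonneg_left (le_trans ?_ hBH) (Real.exp_pos _).le
    have : lam * ψ s + g s = ∫ x, (lam * q (‖x‖ ^ 2) + L s x) ∂(ν s) := by
      rw [integral_add ((hqi s).const_mul _) (hLint s hs), integral_const_mul]
    rw [this]
    refine integral_mono (((hqi s).const_mul _).add (hLint s hs)) hBi fun x => ?_
    refine le_trans ?_ (hBle x)
    -- This is the term produced by the derivative of the cutoff: it enters q'' with a nonpositive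
    -- sign and is dropped.
    have h1 : 0 ≤ ρ (‖x‖ ^ 2) * (‖x‖ ^ 2 * -deriv (smoothCutoff R) (‖x‖ ^ 2)) :=
      mul_nonneg (h0 _ (sq_nonneg _)) (mul_nonneg (sq_nonneg _)
        (neg_nonneg.2 (smoothCutoff.deriv_nonpos hR _)))
    simp only [hL, ha, hq', hq'', radialGenerator, inner_add_right]
    linarith
  linarith
end Lyapunov

/-! ### Removing the truncation. -/

section Limits

variable {d : ℕ}

theorem truncPrimitive.tendsto (ρ : ℝ → ℝ) {s : ℝ} (hs : 0 ≤ s) :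
    Tendsto (fun n : ℕ => truncPrimitive ρ (n + 1) s) atTop (nhds (∫ u in (0 : ℝ)..s, ρ u)) := by
  refine tendsto_const_nhds.congr' ?_
  filter_upwards [eventually_ge_atTop ⌈s⌉₊] with n hn
  refine (truncPrimitive.eq_primitive (by positivity) ?_ hs).symm
  have := (Nat.le_ceil s).trans (Nat.cast_le.2 hn)
  linarith

theorem smoothCutoff.tendsto (s : ℝ) :
    Tendsto (fun n : ℕ => smoothCutoff (n + 1) s) atTop (nhds 1) := by
  refine tendsto_const_nhds.congr' ?_
  filter_upwards [eventually_ge_atTop ⌈s⌉₊] with n hn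
  refine (smoothCutoff.eq_one (by positivity) ?_).symm
  have := (Nat.le_ceil s).trans (Nat.cast_le.2 hn)
  linarith

theorem continuous_primitive_norm_sq {ρ : ℝ → ℝ} (hρ : Continuous ρ) :
    Continuous fun x : EuclideanSpace ℝ (Fin d) => ∫ u in (0 : ℝ)..(‖x‖ ^ 2), ρ u :=
  (intervalIntegral.continuous_primitive (fun a b => hρ.intervalIntegrable a b) 0).comp
    (by fun_prop)

theorem integrable_truncPrimitive {ρ : ℝ → ℝ} (hρ : ContDiff ℝ ∞ ρ)
    (h0 : ∀ s, 0 ≤ s → 0 ≤ ρ s) {R : ℝ} (hR : 0 < R)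
    (ν : Measure (EuclideanSpace ℝ (Fin d))) [IsFiniteMeasure ν] :
    Integrable (fun x => truncPrimitive ρ R (‖x‖ ^ 2)) ν := by
  have hc := (truncPrimitive.contDiff hρ R).continuous
  refine Integrable.mono' (integrable_const (truncPrimitive ρ R (2 * R)))
    (show Continuous fun x : EuclideanSpace ℝ (Fin d) => truncPrimitive ρ R (‖x‖ ^ 2) by
      fun_prop).aestronglyMeasurable (ae_of_all _ fun x => ?_)
  rw [Real.norm_of_nonneg (truncPrimitive.nonneg h0 (sq_nonneg _))]
  exact truncPrimitive.bounded hρ h0 hR (sq_nonneg _)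

/-- Fatou's lemma along the radii R = n + 1, for which the truncations are eventually equal to the
primitive at each point. The shift by one keeps R positive. -/
theorem integrable_primitive_of_truncPrimitive {ρ : ℝ → ℝ} (hρ : ContDiff ℝ ∞ ρ)
    (h0 : ∀ s, 0 ≤ s → 0 ≤ ρ s) {ν : Measure (EuclideanSpace ℝ (Fin d))} [IsFiniteMeasure ν]
    {M : ℝ} (hM : ∀ n : ℕ, ∫ x, truncPrimitive ρ (n + 1) (‖x‖ ^ 2) ∂ν ≤ M) :
    Integrable (fun x => ∫ u in (0 : ℝ)..(‖x‖ ^ 2), ρ u) ν ∧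
      ∫ x, (∫ u in (0 : ℝ)..(‖x‖ ^ 2), ρ u) ∂ν ≤ M := by
  have hp0 : ∀ x : EuclideanSpace ℝ (Fin d), 0 ≤ ∫ u in (0 : ℝ)..(‖x‖ ^ 2), ρ u := fun x =>
    intervalIntegral.integral_nonneg (sq_nonneg _) fun u hu => h0 u hu.1
  have hpc := continuous_primitive_norm_sq (d := d) hρ.continuous
  have hM0 : 0 ≤ M := (integral_nonneg fun x =>
    truncPrimitive.nonneg h0 (sq_nonneg _)).trans (hM 0)
  have hlim : ∫⁻ x, ENNReal.ofReal (∫ u in (0 : ℝ)..(‖x‖ ^ 2), ρ u) ∂ν ≤ ENNReal.ofReal M := by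
    have h1 : ∀ x : EuclideanSpace ℝ (Fin d), liminf (fun n : ℕ =>
        ENNReal.ofReal (truncPrimitive ρ (n + 1) (‖x‖ ^ 2))) atTop
        = ENNReal.ofReal (∫ u in (0 : ℝ)..(‖x‖ ^ 2), ρ u) := fun x =>
      ((ENNReal.continuous_ofReal.tendsto _).comp
        (truncPrimitive.tendsto ρ (sq_nonneg _))).liminf_eq
    simp only [← h1]
    refine (lintegral_liminf_le fun n => ?_).trans ?_
    · have hc := (truncPrimitive.contDiff hρ ((n : ℝ) + 1)).continuous
      exact (ENNReal.continuous_ofReal.comp (hc.comp (by fun_prop))).measurable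
    · refine liminf_le_of_le (by isBoundedDefault) fun b hb => ?_
      obtain ⟨n, hn⟩ := hb.exists
      refine hn.trans ?_
      rw [← ofReal_integral_eq_lintegral_ofReal
        (integrable_truncPrimitive hρ h0 (by positivity) ν)
        (ae_of_all _ fun x => truncPrimitive.nonneg h0 (sq_nonneg _))]
      exact ENNReal.ofReal_le_ofReal (hM n)
  have hint := (integrable_iff_lintegral_lt_top hpc.aestronglyMeasurable hp0).2
    (hlim.trans_lt ENNReal.ofReal_lt_top)
  refine ⟨hint, ?_⟩
  rw [← ofReal_integral_eq_lintegral_ofReal hint (ae_of_all _ hp0)] at hlim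
  exact (ENNReal.ofReal_le_ofReal_iff hM0).1 hlim

end Limits

section Lyapunov

variable {d : ℕ} {V W : EuclideanSpace ℝ (Fin d) → ℝ} {β γ γ' : ℝ}
  {μ : ℝ → ProbabilityMeasure (EuclideanSpace ℝ (Fin d))}
  (hVW : AdmissiblePotentials V W β γ γ') (hμ : IsMcKeanVlasovSolution V W μ)
include hVW hμ

/-- A Lyapunov bound that needs no a priori integrability at positive times. -/
theorem lyapunov_propagation {ρ : ℝ → ℝ} (hρ : ContDiff ℝ ∞ ρ) (h0 : ∀ s, 0 ≤ s → 0 ≤ ρ s)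
    {t A : ℝ} (hA : 0 ≤ A) (ht : 0 ≤ t) {H : ℝ → ℝ} (hH : IntervalIntegrable H volume 0 t)
    (hinit : Integrable (fun x => ∫ u in (0 : ℝ)..(‖x‖ ^ 2), ρ u)
      (μ 0 : Measure (EuclideanSpace ℝ (Fin d))))
    (hle : ∀ᵐ s ∂volume.restrict (Ioc 0 t),
      Integrable (fun x => ‖x‖) (μ s : Measure (EuclideanSpace ℝ (Fin d))) →
      ∃ f : EuclideanSpace ℝ (Fin d) → ℝ,
        Integrable f (μ s : Measure (EuclideanSpace ℝ (Fin d))) ∧ (∀ x, 0 ≤ f x) ∧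
        (∀ x, radialGenerator V W ρ (μ s : Measure (EuclideanSpace ℝ (Fin d))) x
          ≤ A * (∫ u in (0 : ℝ)..(‖x‖ ^ 2), ρ u) + f x) ∧
        ∫ x, f x ∂(μ s : Measure (EuclideanSpace ℝ (Fin d))) ≤ H s) :
    Integrable (fun x => ∫ u in (0 : ℝ)..(‖x‖ ^ 2), ρ u)
      (μ t : Measure (EuclideanSpace ℝ (Fin d))) ∧
    Real.exp (-A * t) * (∫ x, (∫ u in (0 : ℝ)..(‖x‖ ^ 2), ρ u)
        ∂(μ t : Measure (EuclideanSpace ℝ (Fin d))))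
      ≤ ∫ x, (∫ u in (0 : ℝ)..(‖x‖ ^ 2), ρ u) ∂(μ 0 : Measure (EuclideanSpace ℝ (Fin d)))
        + ∫ s in (0 : ℝ)..t, Real.exp (-A * s) * H s := by
  set M := ∫ x, (∫ u in (0 : ℝ)..(‖x‖ ^ 2), ρ u) ∂(μ 0 : Measure (EuclideanSpace ℝ (Fin d)))
        + ∫ s in (0 : ℝ)..t, Real.exp (-A * s) * H s with hM
  have key : ∀ n : ℕ, ∫ x, truncPrimitive ρ (n + 1) (‖x‖ ^ 2)
      ∂(μ t : Measure (EuclideanSpace ℝ (Fin d))) ≤ (Real.exp (-A * t))⁻¹ * M := by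
    intro n
    have hR : (0 : ℝ) < n + 1 := by positivity
    rw [le_inv_mul_iff₀ (Real.exp_pos _)]
    refine (lyapunov_truncated hVW hμ hρ h0 hR ht hH ?_).trans ?_
    · filter_upwards [hle] with s hs hs1
      obtain ⟨f, hfi, hf0, hfle, hfH⟩ := hs hs1
      refine ⟨f, hfi, fun x => ?_, hfH⟩
      have h1 := truncPrimitive.cutoff_mul_primitive_le hρ h0 hR (sq_nonneg ‖x‖)
      have h2 := mul_le_mul_of_nonneg_left (hfle x) (smoothCutoff.nonneg (n + 1) (‖x‖ ^ 2))
      have h3 := mul_le_of_le_one_left (hf0 x) (smoothCutoff.le_one (n + 1) (‖x‖ ^ 2))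
      have h4 := mul_le_mul_of_nonneg_left h1 hA
      nlinarith
    · rw [hM]
      refine add_le_add_left (integral_mono (integrable_truncPrimitive hρ h0 hR _) hinit
        fun x => ?_) _
      exact truncPrimitive.le_primitive hρ h0 (sq_nonneg _)
  have := integrable_primitive_of_truncPrimitive hρ h0 key
  exact ⟨this.1, (le_inv_mul_iff₀ (Real.exp_pos _)).1 this.2⟩

/-- The exact Lyapunov inequality, under a dominating function with bounded moments. -/
theorem lyapunov_dominated {ρ : ℝ → ℝ} (hρ : ContDiff ℝ ∞ ρ) (h0 : ∀ s, 0 ≤ s → 0 ≤ ρ s)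
    {t lam S : ℝ} (ht : 0 ≤ t) {H : ℝ → ℝ} (hH : IntervalIntegrable H volume 0 t)
    {f : EuclideanSpace ℝ (Fin d) → ℝ} (hfc : Continuous f)
    (hpf : ∀ x, ∫ u in (0 : ℝ)..(‖x‖ ^ 2), ρ u ≤ f x)
    (hfi : ∀ s ∈ Icc 0 t, Integrable f (μ s : Measure (EuclideanSpace ℝ (Fin d))))
    (hfS : ∀ s ∈ Icc 0 t, ∫ x, f x ∂(μ s : Measure (EuclideanSpace ℝ (Fin d))) ≤ S)
    (hle : ∀ᵐ s ∂volume.restrict (Ioc 0 t),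
      Integrable (fun x => ‖x‖) (μ s : Measure (EuclideanSpace ℝ (Fin d))) →
      ∃ B : EuclideanSpace ℝ (Fin d) → ℝ, Continuous B ∧ (∀ x, |B x| ≤ f x) ∧
        (∀ x, radialGenerator V W ρ (μ s : Measure (EuclideanSpace ℝ (Fin d))) x ≤ B x) ∧
        lam * (∫ x, (∫ u in (0 : ℝ)..(‖x‖ ^ 2), ρ u) ∂(μ s : Measure (EuclideanSpace ℝ (Fin d))))
          + ∫ x, B x ∂(μ s : Measure (EuclideanSpace ℝ (Fin d))) ≤ H s) :
    Real.exp (lam * t) * (∫ x, (∫ u in (0 : ℝ)..(‖x‖ ^ 2), ρ u)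
        ∂(μ t : Measure (EuclideanSpace ℝ (Fin d))))
      ≤ ∫ x, (∫ u in (0 : ℝ)..(‖x‖ ^ 2), ρ u) ∂(μ 0 : Measure (EuclideanSpace ℝ (Fin d)))
        + ∫ s in (0 : ℝ)..t, Real.exp (lam * s) * H s := by
  set ν : ℝ → Measure (EuclideanSpace ℝ (Fin d)) :=
    fun s => (μ s : Measure (EuclideanSpace ℝ (Fin d))) with hν
  set p : EuclideanSpace ℝ (Fin d) → ℝ := fun x => ∫ u in (0 : ℝ)..(‖x‖ ^ 2), ρ u with hp
  have hp0 : ∀ x : EuclideanSpace ℝ (Fin d), 0 ≤ p x := fun x =>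
    intervalIntegral.integral_nonneg (sq_nonneg _) fun u hu => h0 u hu.1
  have hf0 : ∀ x, 0 ≤ f x := fun x => (hp0 x).trans (hpf x)
  have hpc : Continuous p := continuous_primitive_norm_sq hρ.continuous
  have hpi : ∀ s ∈ Icc 0 t, Integrable p (ν s) := fun s hs =>
    Integrable.mono' (hfi s hs) hpc.aestronglyMeasurable (ae_of_all _ fun x => by
      rw [Real.norm_of_nonneg (hp0 x)]; exact hpf x)
  -- Both truncation errors, p - p_R ≤ p(1 - χ) and χB - B ≤ f(1 - χ), are bounded by f(1 - χ). With
  -- weights |lam| and 1 they give the factor |lam| + 1 below, and dominated convergence, first in x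
  -- and then in s, sends the error to zero.
  set err : ℕ → ℝ → ℝ := fun n s => ∫ x, f x * (1 - smoothCutoff (n + 1) (‖x‖ ^ 2)) ∂(ν s)
    with herr
  have hχc : ∀ n : ℕ, Continuous fun x : EuclideanSpace ℝ (Fin d) =>
      smoothCutoff (n + 1) (‖x‖ ^ 2) := fun n => by
    have := (smoothCutoff.contDiff ((n : ℝ) + 1)).continuous
    fun_prop
  have hgc : ∀ n : ℕ, Continuous fun x : EuclideanSpace ℝ (Fin d) =>
      f x * (1 - smoothCutoff (n + 1) (‖x‖ ^ 2)) := fun n =>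
    hfc.mul (continuous_const.sub (hχc n))
  have hg0 : ∀ (n : ℕ) x, 0 ≤ f x * (1 - smoothCutoff (n + 1) (‖x‖ ^ 2)) := fun n x =>
    mul_nonneg (hf0 x) (sub_nonneg.2 (smoothCutoff.le_one _ _))
  have hgf : ∀ (n : ℕ) x, f x * (1 - smoothCutoff (n + 1) (‖x‖ ^ 2)) ≤ f x := fun n x =>
    mul_le_of_le_one_right (hf0 x) (by linarith [smoothCutoff.nonneg ((n : ℝ) + 1) (‖x‖ ^ 2)])
  have hgi : ∀ n : ℕ, ∀ s ∈ Icc 0 t, Integrable (fun x : EuclideanSpace ℝ (Fin d) =>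
      f x * (1 - smoothCutoff (n + 1) (‖x‖ ^ 2))) (ν s) := fun n s hs =>
    Integrable.mono' (hfi s hs) (hgc n).aestronglyMeasurable (ae_of_all _ fun x => by
      rw [Real.norm_of_nonneg (hg0 n x)]; exact hgf n x)
  have herrS : ∀ n : ℕ, ∀ s ∈ Icc 0 t, ‖err n s‖ ≤ S := fun n s hs => by
    rw [Real.norm_of_nonneg (integral_nonneg (hg0 n))]
    exact (integral_mono (hgi n s hs) (hfi s hs) (hgf n)).trans (hfS s hs)
  have herrm : ∀ n, AEStronglyMeasurable (err n) (volume.restrict (Ioc 0 t)) := fun n =>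
    aestronglyMeasurable_integral_curve hμ.continuousOn
      (F := fun _ x => f x * (1 - smoothCutoff (n + 1) (‖x‖ ^ 2)))
      ((hgc n).comp continuous_snd).stronglyMeasurable t
  have herri : ∀ n, IntervalIntegrable (err n) volume 0 t := fun n => by
    rw [intervalIntegrable_iff, uIoc_of_le ht]
    refine Integrable.mono' (integrable_const S) (herrm n) ?_
    filter_upwards [ae_restrict_mem measurableSet_Ioc] with s hs
    exact herrS n s ⟨hs.1.le, hs.2⟩
  have hec : ContinuousOn (fun s => Real.exp (lam * s)) (uIcc 0 t) := by fun_prop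
  have key : ∀ n : ℕ, Real.exp (lam * t) * ∫ x, truncPrimitive ρ (n + 1) (‖x‖ ^ 2) ∂(ν t)
      ≤ ∫ x, p x ∂(ν 0) + ((∫ s in (0 : ℝ)..t, Real.exp (lam * s) * H s)
        + (|lam| + 1) * ∫ s in (0 : ℝ)..t, Real.exp (lam * s) * err n s) := by
    intro n
    have hR : (0 : ℝ) < n + 1 := by positivity
    have hHn : IntervalIntegrable (fun s => H s + (|lam| + 1) * err n s) volume 0 t :=
      hH.add ((herri n).const_mul _)
    refine (lyapunov_truncated hVW hμ hρ h0 (lam := lam) hR ht hHn ?_).trans ?_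
    · filter_upwards [hle, ae_restrict_mem measurableSet_Ioc] with s hs hst hs1
      have hst' : s ∈ Icc 0 t := ⟨hst.1.le, hst.2⟩
      obtain ⟨B, hBc, hBf, hBle, hBH⟩ := hs hs1
      have hBi : Integrable B (ν s) := Integrable.mono' (hfi s hst') hBc.aestronglyMeasurable
        (ae_of_all _ hBf)
      refine ⟨fun x => lam * p x + B x
        + (|lam| + 1) * (f x * (1 - smoothCutoff (n + 1) (‖x‖ ^ 2))),
        (((hpi s hst').const_mul _).add hBi).add ((hgi n s hst').const_mul _), fun x => ?_, ?_⟩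
      · have hχ0 := smoothCutoff.nonneg ((n : ℝ) + 1) (‖x‖ ^ 2)
        have hχ1 := smoothCutoff.le_one ((n : ℝ) + 1) (‖x‖ ^ 2)
        have h1 := truncPrimitive.cutoff_mul_primitive_le hρ h0 hR (sq_nonneg ‖x‖)
        have h2 := truncPrimitive.le_primitive hρ h0 (R := (n : ℝ) + 1) (sq_nonneg ‖x‖)
        have h3 := mul_le_mul_of_nonneg_left (hBle x) hχ0
        have h4 : -(B x) * (1 - smoothCutoff (n + 1) (‖x‖ ^ 2))
            ≤ f x * (1 - smoothCutoff (n + 1) (‖x‖ ^ 2)) :=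
          mul_le_mul_of_nonneg_right ((neg_le_abs _).trans (hBf x)) (sub_nonneg.2 hχ1)
        have h5 : lam * (truncPrimitive ρ (n + 1) (‖x‖ ^ 2) - p x)
            ≤ |lam| * (f x * (1 - smoothCutoff (n + 1) (‖x‖ ^ 2))) := by
          refine (le_abs_self _).trans ?_
          rw [abs_mul]
          refine mul_le_mul_of_nonneg_left ?_ (abs_nonneg _)
          rw [abs_of_nonpos (sub_nonpos.2 h2)]
          have := mul_le_mul_of_nonneg_right (hpf x) (sub_nonneg.2 hχ1)
          change p x * _ ≤ _ at this
          change _ * p x ≤ _ at h1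
          linarith
        linarith
      · have e1 : ∫ x, (lam * p x + B x
            + (|lam| + 1) * (f x * (1 - smoothCutoff (n + 1) (‖x‖ ^ 2)))) ∂(ν s)
            = (lam * ∫ x, p x ∂(ν s)) + (∫ x, B x ∂(ν s)) + (|lam| + 1) * err n s := by
          have hpB : Integrable (fun x => lam * p x + B x) (ν s) :=
            ((hpi s hst').const_mul _).add hBi
          rw [integral_add hpB ((hgi n s hst').const_mul _),
            integral_add ((hpi s hst').const_mul _) hBi, integral_const_mul, integral_const_mul]
        change ∫ x, (lam * p x + B x
            + (|lam| + 1) * (f x * (1 - smoothCutoff (n + 1) (‖x‖ ^ 2)))) ∂(ν s) ≤ _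
        rw [e1]
        linarith
    · refine add_le_add (integral_mono (integrable_truncPrimitive hρ h0 hR _)
        (hpi 0 ⟨le_rfl, ht⟩) fun x => truncPrimitive.le_primitive hρ h0 (sq_nonneg _)) (le_of_eq ?_)
      rw [← intervalIntegral.integral_const_mul, ← intervalIntegral.integral_add
        (hH.continuousOn_mul hec) (((herri n).continuousOn_mul hec).const_mul _)]
      exact intervalIntegral.integral_congr fun s _ => by ring
  have hlhs : Tendsto (fun n : ℕ => Real.exp (lam * t) *
      ∫ x, truncPrimitive ρ (n + 1) (‖x‖ ^ 2) ∂(ν t)) atTop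
      (nhds (Real.exp (lam * t) * ∫ x, p x ∂(ν t))) := by
    refine Tendsto.const_mul _ (tendsto_integral_of_dominated_convergence p (fun n => ?_)
      (hpi t ⟨ht, le_rfl⟩) (fun n => ae_of_all _ fun x => ?_) (ae_of_all _ fun x => ?_))
    · exact (integrable_truncPrimitive hρ h0 (by positivity) _).aestronglyMeasurable
    · rw [Real.norm_of_nonneg (truncPrimitive.nonneg h0 (sq_nonneg _))]
      exact truncPrimitive.le_primitive hρ h0 (sq_nonneg _)
    · exact truncPrimitive.tendsto ρ (sq_nonneg _)
  have herr0 : ∀ s ∈ Icc 0 t, Tendsto (fun n => err n s) atTop (nhds 0) := fun s hs => by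
    have := tendsto_integral_of_dominated_convergence (μ := ν s) (F := fun (n : ℕ) x =>
      f x * (1 - smoothCutoff (n + 1) (‖x‖ ^ 2))) (f := fun _ => 0) f
      (fun n => (hgc n).aestronglyMeasurable) (hfi s hs)
      (fun n => ae_of_all _ fun x => by rw [Real.norm_of_nonneg (hg0 n x)]; exact hgf n x)
      (ae_of_all _ fun x => by
        simpa using ((smoothCutoff.tendsto (‖x‖ ^ 2)).const_sub 1).const_mul (f x))
    simpa using this
  have hint0 : Tendsto (fun n => ∫ s in (0 : ℝ)..t, Real.exp (lam * s) * err n s) atTop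
      (nhds 0) := by
    have := intervalIntegral.tendsto_integral_filter_of_dominated_convergence (a := 0) (b := t)
      (μ := volume) (l := atTop) (F := fun (n : ℕ) s => Real.exp (lam * s) * err n s)
      (f := fun _ => 0) (fun s => Real.exp (lam * s) * S)
      (Eventually.of_forall fun n => by
        rw [uIoc_of_le ht]
        exact (by fun_prop : Continuous fun s => Real.exp (lam * s)).aestronglyMeasurable.mul
          (herrm n))
      (Eventually.of_forall fun n => ae_of_all _ fun s hs => by
        rw [uIoc_of_le ht] at hs
        rw [norm_mul, Real.norm_of_nonneg (Real.exp_pos _).le]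
        exact mul_le_mul_of_nonneg_left (herrS n s ⟨hs.1.le, hs.2⟩) (Real.exp_pos _).le)
      ((by fun_prop : Continuous fun s => Real.exp (lam * s) * S).intervalIntegrable _ _)
      (ae_of_all _ fun s hs => by
        rw [uIoc_of_le ht] at hs
        simpa using (herr0 s ⟨hs.1.le, hs.2⟩).const_mul (Real.exp (lam * s)))
    simpa using this
  have hrhs := (hint0.const_mul (|lam| + 1)).const_add
    (∫ s in (0 : ℝ)..t, Real.exp (lam * s) * H s)
  have hrhs' := hrhs.const_add (∫ x, p x ∂(ν 0))
  simp only [mul_zero, add_zero] at hrhs'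
  exact le_of_tendsto_of_tendsto' hlhs hrhs' key

end Lyapunov

/-! ### Generator bounds for power weights and for a weight of linear growth. -/

section GeneratorBounds

variable {d : ℕ} {V W : EuclideanSpace ℝ (Fin d) → ℝ} {β γ γ' : ℝ}
  (hVW : AdmissiblePotentials V W β γ γ')
  {ν : Measure (EuclideanSpace ℝ (Fin d))} [IsProbabilityMeasure ν]

theorem contDiff_pow_weight (j : ℕ) : ContDiff ℝ ∞ fun u : ℝ => ((j : ℝ) + 1) * u ^ j := by
  fun_prop

theorem pow_weight_nonneg (j : ℕ) (s : ℝ) (hs : 0 ≤ s) : 0 ≤ ((j : ℝ) + 1) * s ^ j := by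
  positivity

theorem integral_pow_weight (j : ℕ) (s : ℝ) :
    ∫ u in (0 : ℝ)..s, ((j : ℝ) + 1) * u ^ j = s ^ (j + 1) := by
  rw [intervalIntegral.integral_const_mul, integral_pow]
  have : (j : ℝ) + 1 ≠ 0 := by positivity
  field_simp
  simp

include hVW in
-- Young's inequality with parameter δ splits the term ‖x‖N coming from ∇V(0) and the mean field.
-- The sign of κ is free: a nonnegative κ serves the local bounds, a negative one the uniformly
-- convex case.
theorem AdmissiblePotentials.radialGenerator_pow_le (hν : Integrable (fun y => ‖y‖) ν)
    {N δ κ : ℝ} (hN : ‖(∇ V) 0‖ + max |γ| |γ'| * ∫ y, ‖y‖ ∂ν ≤ N) (hδ : 0 < δ)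
    (hκ : δ - (β + γ) ≤ κ) (j : ℕ) (x : EuclideanSpace ℝ (Fin d)) :
    radialGenerator V W (fun u => ((j : ℝ) + 1) * u ^ j) ν x
      ≤ 2 * (j + 1) * κ * (‖x‖ ^ 2) ^ (j + 1)
        + 2 * (j + 1) ^ 2 * (d + 2 + N ^ 2 / (4 * δ)) * (‖x‖ ^ 2) ^ j := by
  have h1 := hVW.inner_drift_ge hν x
  have hder : deriv (fun u : ℝ => ((j : ℝ) + 1) * u ^ j) (‖x‖ ^ 2)
      = ((j : ℝ) + 1) * (j * (‖x‖ ^ 2) ^ (j - 1)) := by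
    simp
  -- The truncated subtraction j - 1 is harmless at j = 0, where the factor j vanishes.
  have hj : ‖x‖ ^ 2 * (j * (‖x‖ ^ 2) ^ (j - 1)) = j * (‖x‖ ^ 2) ^ j := by
    rcases j with _ | j
    · simp
    · rw [Nat.add_sub_cancel]; ring
  have hy : ‖x‖ * N ≤ δ * ‖x‖ ^ 2 + N ^ 2 / (4 * δ) := by
    have : δ * ‖x‖ ^ 2 + N ^ 2 / (4 * δ) - ‖x‖ * N = (2 * δ * ‖x‖ - N) ^ 2 / (4 * δ) := by
      field_simp
      ring
    have h2 : 0 ≤ (2 * δ * ‖x‖ - N) ^ 2 / (4 * δ) := by positivity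
    linarith
  have hN' := mul_le_mul_of_nonneg_left hN (norm_nonneg x)
  have hκ' := mul_le_mul_of_nonneg_right hκ (sq_nonneg ‖x‖)
  have hq : 0 ≤ N ^ 2 / (4 * δ) := by positivity
  have hjj : (0 : ℝ) ≤ j := Nat.cast_nonneg j
  have hjq : 0 ≤ (j : ℝ) * (d + N ^ 2 / (4 * δ)) := by positivity
  have hmain : 2 * d - 2 * ⟪x, (∇ V) x + gradConv W ν x⟫_ℝ + 4 * j
      ≤ 2 * κ * ‖x‖ ^ 2 + 2 * (j + 1) * (d + 2 + N ^ 2 / (4 * δ)) := by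
    linarith
  have hpos : 0 ≤ ((j : ℝ) + 1) * (‖x‖ ^ 2) ^ j := by positivity
  have := mul_le_mul_of_nonneg_left hmain hpos
  unfold radialGenerator
  rw [hder]
  have e : 4 * ‖x‖ ^ 2 * (((j : ℝ) + 1) * (j * (‖x‖ ^ 2) ^ (j - 1)))
      = 4 * (j + 1) * (j * (‖x‖ ^ 2) ^ j) := by rw [← hj]; ring
  rw [e, pow_succ (‖x‖ ^ 2) j]
  linarith

/-- A smooth weight whose primitive behaves like `s ↦ 2 √s`. -/
noncomputable def rootWeight (s : ℝ) : ℝ := (1 + s ^ 2) ^ (-(1 / 4 : ℝ))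

namespace rootWeight

theorem pos (s : ℝ) : 0 < rootWeight s := Real.rpow_pos_of_pos (by positivity) _

theorem le_one (s : ℝ) : rootWeight s ≤ 1 :=
  Real.rpow_le_one_of_one_le_of_nonpos (by nlinarith [sq_nonneg s]) (by norm_num)

theorem contDiff : ContDiff ℝ ∞ rootWeight :=
  ContDiff.rpow_const_of_ne (by fun_prop) fun s => by positivity

theorem antitoneOn : AntitoneOn rootWeight (Ici 0) := fun a ha b _ hab =>
  Real.rpow_le_rpow_of_nonpos (by positivity)
    (by have : (0 : ℝ) ≤ a := ha; gcongr) (by norm_num)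

theorem deriv_nonpos {s : ℝ} (hs : 0 ≤ s) : deriv rootWeight s ≤ 0 := by
  have h1 : HasDerivAt (fun s : ℝ => 1 + s ^ 2) (2 * s) s := by
    simpa using (hasDerivAt_pow 2 s).const_add 1
  have h2 := h1.rpow_const (p := -(1 / 4 : ℝ)) (Or.inl (by positivity))
  rw [show rootWeight = fun s => (1 + s ^ 2) ^ (-(1 / 4 : ℝ)) from rfl, h2.deriv]
  have : 0 ≤ (1 + s ^ 2) ^ (-(1 / 4 : ℝ) - 1) := Real.rpow_nonneg (by positivity) _
  nlinarith [mul_nonneg hs this]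

/-- Raising to the fourth power turns comparisons of the weight with r into polynomial inequalities.
-/
theorem inv_pow_four (s : ℝ) : (rootWeight s)⁻¹ ^ 4 = 1 + s ^ 2 := by
  have h : (0 : ℝ) ≤ 1 + s ^ 2 := by positivity
  rw [rootWeight, ← Real.rpow_neg h, ← Real.rpow_natCast, ← Real.rpow_mul h]
  norm_num

theorem mul_le_one (r : ℝ) : rootWeight (r ^ 2) * r ≤ 1 := by
  have h : r ≤ (rootWeight (r ^ 2))⁻¹ := by
    refine le_of_pow_le_pow_left₀ (n := 4) (by norm_num) (inv_nonneg.2 (pos _).le) ?_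
    rw [inv_pow_four]
    nlinarith
  rwa [mul_comm, ← le_div_iff₀ (pos _), one_div]

/-- The weight is nonincreasing, so the primitive at r² is at least r² times the weight there, and
for r ≥ 1 that weight is at least 1/(2r). -/
theorem le_primitive {r : ℝ} (hr : 0 ≤ r) :
    r ≤ 1 + 2 * ∫ u in (0 : ℝ)..(r ^ 2), rootWeight u := by
  have hI : ∫ _ in (0 : ℝ)..(r ^ 2), rootWeight (r ^ 2) ≤ ∫ u in (0 : ℝ)..(r ^ 2), rootWeight u :=
    intervalIntegral.integral_mono_on (sq_nonneg r) intervalIntegrable_const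
      (contDiff.continuous.intervalIntegrable _ _) fun u hu =>
        antitoneOn hu.1 (sq_nonneg r) hu.2
  simp only [intervalIntegral.integral_const, sub_zero, smul_eq_mul] at hI
  rcases le_total r 1 with h | h
  · have : 0 ≤ r ^ 2 * rootWeight (r ^ 2) := mul_nonneg (sq_nonneg r) (pos _).le
    linarith
  · have h1 : (rootWeight (r ^ 2))⁻¹ ≤ 2 * r := by
      refine le_of_pow_le_pow_left₀ (n := 4) (by norm_num) (by positivity) ?_
      rw [inv_pow_four]
      nlinarith [one_le_pow₀ h (n := 4)]
    have h2 : 1 ≤ 2 * r * rootWeight (r ^ 2) := by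
      rw [inv_le_iff_one_le_mul₀ (pos _)] at h1
      linarith
    nlinarith

theorem primitive_le {s : ℝ} (hs : 0 ≤ s) : ∫ u in (0 : ℝ)..s, rootWeight u ≤ s := by
  have hI : ∫ u in (0 : ℝ)..s, rootWeight u ≤ ∫ _ in (0 : ℝ)..s, (1 : ℝ) :=
    intervalIntegral.integral_mono_on hs (contDiff.continuous.intervalIntegrable _ _)
      intervalIntegrable_const fun u _ => le_one u
  simpa using hI

end rootWeight

include hVW in
-- The weight gains one power of ‖x‖ over the quadratic drift bound, and its derivative term is
-- nonpositive. What remains is affine in ‖x‖ and in the first moment of ν, hence integrable in time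
-- along a solution.
theorem AdmissiblePotentials.radialGenerator_rootWeight_le (hν : Integrable (fun y => ‖y‖) ν)
    (x : EuclideanSpace ℝ (Fin d)) :
    radialGenerator V W rootWeight ν x
      ≤ 2 * d + 2 * |β + γ| * ‖x‖ + 2 * (‖(∇ V) 0‖ + max |γ| |γ'| * ∫ y, ‖y‖ ∂ν) := by
  set N := ‖(∇ V) 0‖ + max |γ| |γ'| * ∫ y, ‖y‖ ∂ν with hN
  have hN0 : 0 ≤ N := add_nonneg (norm_nonneg _) (mul_nonneg (le_max_of_le_left (abs_nonneg _))
    (integral_nonneg fun y => norm_nonneg y))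
  have h1 := hVW.inner_drift_ge hν x
  have hw := rootWeight.pos (‖x‖ ^ 2)
  have hw1 := rootWeight.le_one (‖x‖ ^ 2)
  have hwx := rootWeight.mul_le_one ‖x‖
  have hder := mul_nonneg (sq_nonneg ‖x‖) (neg_nonneg.2 (rootWeight.deriv_nonpos (sq_nonneg ‖x‖)))
  have hc : -(β + γ) * ‖x‖ ^ 2 ≤ |β + γ| * ‖x‖ ^ 2 :=
    mul_le_mul_of_nonneg_right (neg_le_abs _) (sq_nonneg _)
  have h2 : 2 * d - 2 * ⟪x, (∇ V) x + gradConv W ν x⟫_ℝ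
      ≤ 2 * d + 2 * (|β + γ| * ‖x‖ ^ 2) + 2 * (‖x‖ * N) := by linarith
  have h3 := mul_le_mul_of_nonneg_left h2 hw.le
  have h4 : rootWeight (‖x‖ ^ 2) * (2 * d) ≤ 2 * d :=
    mul_le_of_le_one_left (by positivity) hw1
  have h5 : (rootWeight (‖x‖ ^ 2) * ‖x‖) * (|β + γ| * ‖x‖) ≤ |β + γ| * ‖x‖ :=
    mul_le_of_le_one_left (by positivity) hwx
  have h6 : (rootWeight (‖x‖ ^ 2) * ‖x‖) * N ≤ N := mul_le_of_le_one_left hN0 hwx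
  unfold radialGenerator
  nlinarith

end GeneratorBounds

/-! ### First moment and even moments on bounded time intervals. -/

section Moments

variable {d : ℕ} {V W : EuclideanSpace ℝ (Fin d) → ℝ} {β γ γ' : ℝ}
  {μ : ℝ → ProbabilityMeasure (EuclideanSpace ℝ (Fin d))}
  (hVW : AdmissiblePotentials V W β γ γ') (hμ : IsMcKeanVlasovSolution V W μ)
include hVW hμ

/-- Upgrades time integrability of the first moment to a bound at every time, by Lyapunov
propagation with A = 0. Monotonicity of m bounds the mean field on [0, t] by a constant; continuity
of m is needed for the continuity of α in (ii). -/
theorem exists_bound_first_moment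
    (hinit : Integrable (fun x => ‖x‖ ^ 2) (μ 0 : Measure (EuclideanSpace ℝ (Fin d)))) :
    ∃ m : ℝ → ℝ, ContinuousOn m (Ici 0) ∧ MonotoneOn m (Ici 0) ∧ ∀ t, 0 ≤ t →
      Integrable (fun x => ‖x‖) (μ t : Measure (EuclideanSpace ℝ (Fin d))) ∧
      ∫ x, ‖x‖ ∂(μ t : Measure (EuclideanSpace ℝ (Fin d))) ≤ m t := by
  set K := max |γ| |γ'| with hK
  have hK0 : 0 ≤ K := le_max_of_le_left (abs_nonneg _)
  set M : ℝ → ℝ := fun s => ∫ x, ‖x‖ ∂(μ s : Measure (EuclideanSpace ℝ (Fin d))) with hM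
  have hM0 : ∀ s, 0 ≤ M s := fun s => integral_nonneg fun x => norm_nonneg x
  set H : ℝ → ℝ := fun s => 2 * d + 2 * |β + γ| * M s + 2 * (‖(∇ V) 0‖ + K * M s) with hH
  have hH0 : ∀ s, 0 ≤ H s := fun s => by have := hM0 s; positivity
  have hHi : ∀ t, 0 ≤ t → IntervalIntegrable H volume 0 t := fun t ht => by
    have := hμ.intervalIntegrable_integral_norm ht
    exact (intervalIntegrable_const.add (this.const_mul _)).add
      ((intervalIntegrable_const.add (this.const_mul _)).const_mul _)
  set P : EuclideanSpace ℝ (Fin d) → ℝ := fun x => ∫ u in (0 : ℝ)..(‖x‖ ^ 2), rootWeight u with hP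
  have hPc : Continuous P := continuous_primitive_norm_sq rootWeight.contDiff.continuous
  have hP0 : ∀ x, 0 ≤ P x := fun x =>
    intervalIntegral.integral_nonneg (sq_nonneg _) fun u _ => (rootWeight.pos u).le
  have hPi : Integrable P (μ 0 : Measure (EuclideanSpace ℝ (Fin d))) :=
    hinit.mono' hPc.aestronglyMeasurable (ae_of_all _ fun x => by
      rw [Real.norm_of_nonneg (hP0 x)]; exact rootWeight.primitive_le (sq_nonneg _))
  have hHcont : ContinuousOn (fun t => ∫ s in (0 : ℝ)..t, H s) (Ici 0) := by
    intro t ht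
    have ht0 : (0 : ℝ) ≤ t := ht
    have h1 := intervalIntegral.continuousOn_primitive_interval (μ := volume) (f := H)
      (a := 0) (b := t + 1) (by
        have := (hHi (t + 1) (by linarith)).1
        rw [uIcc_of_le (by linarith)]
        exact (integrableOn_Icc_iff_integrableOn_Ioc).2 this)
    rw [uIcc_of_le (by linarith)] at h1
    refine (h1 t ⟨ht, by linarith⟩).mono_of_mem_nhdsWithin ?_
    have : Iio (t + 1) ∈ nhds t := Iio_mem_nhds (by linarith)
    filter_upwards [self_mem_nhdsWithin, mem_nhdsWithin_of_mem_nhds this] with u hu hu'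
    exact ⟨hu, le_of_lt hu'⟩
  refine ⟨fun t => 1 + 2 * (∫ x, P x ∂(μ 0 : Measure (EuclideanSpace ℝ (Fin d)))
    + ∫ s in (0 : ℝ)..t, H s), by fun_prop, fun a ha b hb hab => ?_, fun t ht => ?_⟩
  · have : ∫ s in (0 : ℝ)..a, H s ≤ ∫ s in (0 : ℝ)..b, H s :=
      intervalIntegral.integral_mono_interval le_rfl ha hab (ae_of_all _ hH0) (hHi b hb)
    simp only
    linarith
  · have hprop := lyapunov_propagation hVW hμ rootWeight.contDiff
      (fun s _ => (rootWeight.pos s).le) le_rfl ht (hHi t ht) hPi (by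
        refine ae_of_all _ fun s hs => ⟨fun x => 2 * d + 2 * |β + γ| * ‖x‖
          + 2 * (‖(∇ V) 0‖ + K * M s), ?_, fun x => ?_, fun x => ?_, ?_⟩
        · exact ((integrable_const _).add (hs.const_mul _)).add (integrable_const _)
        · have := hM0 s; positivity
        · rw [zero_mul, zero_add]
          exact hVW.radialGenerator_rootWeight_le hs x
        · refine le_of_eq ?_
          have hs' : Integrable (fun x => 2 * d + 2 * |β + γ| * ‖x‖)
              (μ s : Measure (EuclideanSpace ℝ (Fin d))) :=
            (integrable_const _).add (hs.const_mul _)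
          rw [integral_add hs' (integrable_const _),
            integral_add (integrable_const _) (hs.const_mul _)]
          simp only [hH, hM, integral_const, probReal_univ, one_smul, add_left_inj, add_right_inj]
          exact integral_const_mul _ _)
    obtain ⟨hPt, hle⟩ := hprop
    simp only [neg_zero, zero_mul, Real.exp_zero, one_mul] at hle
    have hb : ∀ x, ‖x‖ ≤ 1 + 2 * P x := fun x => rootWeight.le_primitive (norm_nonneg x)
    have hi : Integrable (fun x => 1 + 2 * P x) (μ t : Measure (EuclideanSpace ℝ (Fin d))) :=
      (integrable_const _).add (hPt.const_mul _)
    have hnorm : Integrable (fun x => ‖x‖) (μ t : Measure (EuclideanSpace ℝ (Fin d))) :=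
      hi.mono' (by fun_prop) (ae_of_all _ fun x => by rw [norm_norm]; exact hb x)
    refine ⟨hnorm, (integral_mono hnorm hi hb).trans ?_⟩
    rw [integral_add (integrable_const _) (hPt.const_mul _), integral_const_mul]
    simp only [integral_const, probReal_univ, one_smul]
    linarith

theorem pow_moment_step {t m δ κ : ℝ} (ht : 0 ≤ t) (hδ : 0 < δ) (hκ0 : 0 ≤ κ)
    (hκ : δ - (β + γ) ≤ κ)
    (hm : ∀ s ∈ Ioc 0 t, ∫ x, ‖x‖ ∂(μ s : Measure (EuclideanSpace ℝ (Fin d))) ≤ m) (j : ℕ)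
    {Y : ℝ → ℝ} (hY : Continuous Y)
    (hj : ∀ s ∈ Ioc 0 t,
      Integrable (fun x => (‖x‖ ^ 2) ^ j) (μ s : Measure (EuclideanSpace ℝ (Fin d))) ∧
      ∫ x, (‖x‖ ^ 2) ^ j ∂(μ s : Measure (EuclideanSpace ℝ (Fin d))) ≤ Y s)
    (hinit : Integrable (fun x => (‖x‖ ^ 2) ^ (j + 1))
      (μ 0 : Measure (EuclideanSpace ℝ (Fin d)))) :
    Integrable (fun x => (‖x‖ ^ 2) ^ (j + 1)) (μ t : Measure (EuclideanSpace ℝ (Fin d))) ∧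
    Real.exp (-(2 * (j + 1) * κ) * t) *
        ∫ x, (‖x‖ ^ 2) ^ (j + 1) ∂(μ t : Measure (EuclideanSpace ℝ (Fin d)))
      ≤ ∫ x, (‖x‖ ^ 2) ^ (j + 1) ∂(μ 0 : Measure (EuclideanSpace ℝ (Fin d)))
        + ∫ s in (0 : ℝ)..t, Real.exp (-(2 * (j + 1) * κ) * s) *
          (2 * (j + 1) ^ 2 * (d + 2 + (‖(∇ V) 0‖ + max |γ| |γ'| * m) ^ 2 / (4 * δ)) * Y s) := by
  set N := ‖(∇ V) 0‖ + max |γ| |γ'| * m with hN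
  have hK0 : 0 ≤ max |γ| |γ'| := le_max_of_le_left (abs_nonneg _)
  have h := lyapunov_propagation hVW hμ (contDiff_pow_weight j) (pow_weight_nonneg j)
    (A := 2 * (j + 1) * κ) (t := t)
    (H := fun s => 2 * (j + 1) ^ 2 * (d + 2 + N ^ 2 / (4 * δ)) * Y s)
    (by positivity) ht ((hY.const_mul _).intervalIntegrable _ _)
    (by simpa only [integral_pow_weight] using hinit) (by
      filter_upwards [ae_restrict_mem measurableSet_Ioc] with s hs hs1
      refine ⟨fun x => 2 * (j + 1) ^ 2 * (d + 2 + N ^ 2 / (4 * δ)) * (‖x‖ ^ 2) ^ j,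
        (hj s hs).1.const_mul _, fun x => by positivity, fun x => ?_, ?_⟩
      · rw [integral_pow_weight]
        exact hVW.radialGenerator_pow_le hs1 (add_le_add_right
          (mul_le_mul_of_nonneg_left (hm s hs) hK0) _) hδ hκ j x
      · rw [integral_const_mul]
        exact mul_le_mul_of_nonneg_left (hj s hs).2 (by positivity))
  simpa only [integral_pow_weight] using h

/-- Induction on k through the linear differential inequality relating consecutive moments. The
coefficient 2(j+1)²C times j! equals (j+1)! times 2(j+1)C, so the source integrates exactly to a
difference of powers of l + 2Cs. -/
theorem pow_moments_bound {T m δ κ D l : ℝ} (hδ : 0 < δ) (hκ0 : 0 ≤ κ) (hl : 0 ≤ l) (hD : 1 ≤ D)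
    (hκ : δ - (β + γ) ≤ κ)
    (hm : ∀ s ∈ Ioc 0 T, ∫ x, ‖x‖ ∂(μ s : Measure (EuclideanSpace ℝ (Fin d))) ≤ m)
    {C : ℝ} (hC : C = d + 2 + (‖(∇ V) 0‖ + max |γ| |γ'| * m) ^ 2 / (4 * δ))
    (hinit : ∀ k : ℕ, Integrable (fun x => (‖x‖ ^ 2) ^ k)
        (μ 0 : Measure (EuclideanSpace ℝ (Fin d))) ∧
      ∫ x, (‖x‖ ^ 2) ^ k ∂(μ 0 : Measure (EuclideanSpace ℝ (Fin d))) ≤ D * k.factorial * l ^ k)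
    (k : ℕ) : ∀ t ∈ Icc 0 T, Integrable (fun x => (‖x‖ ^ 2) ^ k)
        (μ t : Measure (EuclideanSpace ℝ (Fin d))) ∧
      ∫ x, (‖x‖ ^ 2) ^ k ∂(μ t : Measure (EuclideanSpace ℝ (Fin d)))
        ≤ D * k.factorial * (Real.exp (2 * κ * t) * (l + 2 * C * t)) ^ k := by
  have hC0 : 0 ≤ C := by rw [hC]; positivity
  induction k with
  | zero => intro t _; simpa using hD
  | succ j ih =>
    intro t ht
    obtain ⟨h1, h2⟩ := pow_moment_step hVW hμ ht.1 hδ hκ0 hκ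
      (fun s hs => hm s ⟨hs.1, hs.2.trans ht.2⟩) j
      (Y := fun s => D * j.factorial * (Real.exp (2 * κ * s) * (l + 2 * C * s)) ^ j)
      (by fun_prop) (fun s hs => ih s ⟨hs.1.le, hs.2.trans ht.2⟩) (hinit (j + 1)).1
    refine ⟨h1, ?_⟩
    rw [← hC] at h2
    have h3 : ∫ s in (0 : ℝ)..t, Real.exp (-(2 * (j + 1) * κ) * s) *
        (2 * (j + 1) ^ 2 * C * (D * j.factorial * (Real.exp (2 * κ * s) * (l + 2 * C * s)) ^ j))
        ≤ ∫ s in (0 : ℝ)..t, D * (j + 1).factorial *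
          ((j + 1) * (l + 2 * C * s) ^ j * (2 * C)) := by
      refine intervalIntegral.integral_mono_on ht.1
        ((by fun_prop : Continuous _).intervalIntegrable _ _)
        ((by fun_prop : Continuous _).intervalIntegrable _ _) fun s hs => ?_
      have hs0 : 0 ≤ s := hs.1
      -- Here κ ≥ 0 is used: the total exponent is -2κs.
      have e1 : Real.exp (-(2 * (j + 1) * κ) * s) * Real.exp (2 * κ * s) ^ j ≤ 1 := by
        rw [← Real.exp_nat_mul, ← Real.exp_add, Real.exp_le_one_iff]
        have : 0 ≤ κ * s := mul_nonneg hκ0 hs0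
        linarith
      have e2 : 0 ≤ D * (j + 1).factorial * ((j + 1) * (l + 2 * C * s) ^ j * (2 * C)) := by
        positivity
      calc _ = (Real.exp (-(2 * (j + 1) * κ) * s) * Real.exp (2 * κ * s) ^ j) *
          (D * (j + 1).factorial * ((j + 1) * (l + 2 * C * s) ^ j * (2 * C))) := by
            rw [mul_pow, Nat.factorial_succ]
            push_cast
            ring
        _ ≤ _ := mul_le_of_le_one_left e2 e1
    have h4 : ∫ s in (0 : ℝ)..t, D * (j + 1).factorial * ((j + 1) * (l + 2 * C * s) ^ j * (2 * C))
        = D * (j + 1).factorial * ((l + 2 * C * t) ^ (j + 1) - l ^ (j + 1)) := by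
      rw [intervalIntegral.integral_const_mul]
      congr 1
      have hder : ∀ s ∈ uIcc 0 t, HasDerivAt (fun s : ℝ => (l + 2 * C * s) ^ (j + 1))
          ((j + 1) * (l + 2 * C * s) ^ j * (2 * C)) s := fun s _ => by
        have := (((hasDerivAt_id s).const_mul (2 * C)).const_add l).fun_pow (j + 1)
        simpa using this
      rw [intervalIntegral.integral_eq_sub_of_hasDerivAt hder
        ((by fun_prop : Continuous _).intervalIntegrable _ _)]
      simp
    have h5 := (hinit (j + 1)).2
    have h6 : Real.exp (-(2 * (j + 1) * κ) * t) *
        ∫ x, (‖x‖ ^ 2) ^ (j + 1) ∂(μ t : Measure (EuclideanSpace ℝ (Fin d)))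
        ≤ D * (j + 1).factorial * (l + 2 * C * t) ^ (j + 1) := by linarith
    rw [neg_mul, Real.exp_neg, inv_mul_le_iff₀ (Real.exp_pos _)] at h6
    refine h6.trans_eq ?_
    rw [mul_pow, ← Real.exp_nat_mul]
    push_cast
    ring_nf

end Moments

/-! ### Square-exponential moments and factorial growth of even moments. -/

section SquareExponential

variable {d : ℕ}

theorem integrable_norm_sq_iff (ν : ProbabilityMeasure (EuclideanSpace ℝ (Fin d))) :
    Integrable (fun x => ‖x‖ ^ 2) (ν : Measure (EuclideanSpace ℝ (Fin d))) ↔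
      secondMoment ν < ⊤ :=
  integrable_iff_lintegral_lt_top (by fun_prop) fun _ => sq_nonneg _

theorem secondMoment_eq_ofReal {ν : ProbabilityMeasure (EuclideanSpace ℝ (Fin d))}
    (h : Integrable (fun x => ‖x‖ ^ 2) (ν : Measure (EuclideanSpace ℝ (Fin d)))) :
    secondMoment ν = ENNReal.ofReal (∫ x, ‖x‖ ^ 2 ∂(ν : Measure (EuclideanSpace ℝ (Fin d)))) :=
  (ofReal_integral_eq_lintegral_ofReal h (ae_of_all _ fun _ => sq_nonneg _)).symm

/-- Integrate y^k ≤ k! e^y at y = α|x|². The constant D is the square-exponential moment itself. -/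
theorem exists_pow_moments_bound_of_sqExpMoment {α : ℝ} (hα : 0 < α)
    {ν : ProbabilityMeasure (EuclideanSpace ℝ (Fin d))} (h : sqExpMoment α ν < ⊤) :
    ∃ D : ℝ, 1 ≤ D ∧ ∀ k : ℕ,
      Integrable (fun x => (‖x‖ ^ 2) ^ k) (ν : Measure (EuclideanSpace ℝ (Fin d))) ∧
      ∫ x, (‖x‖ ^ 2) ^ k ∂(ν : Measure (EuclideanSpace ℝ (Fin d)))
        ≤ D * k.factorial * α⁻¹ ^ k := by
  have hi : Integrable (fun x => Real.exp (α * ‖x‖ ^ 2))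
      (ν : Measure (EuclideanSpace ℝ (Fin d))) :=
    (integrable_iff_lintegral_lt_top (by fun_prop) fun _ => (Real.exp_pos _).le).2 h
  have hle : ∀ (k : ℕ) (x : EuclideanSpace ℝ (Fin d)),
      (‖x‖ ^ 2) ^ k ≤ Real.exp (α * ‖x‖ ^ 2) * (k.factorial * α⁻¹ ^ k) := by
    intro k x
    have h1 := Real.pow_div_factorial_le_exp (α * ‖x‖ ^ 2) (by positivity) k
    rw [div_le_iff₀ (by positivity), mul_pow] at h1
    rw [inv_pow, ← mul_assoc, ← div_eq_mul_inv, le_div_iff₀ (by positivity)]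
    linarith
  refine ⟨∫ x, Real.exp (α * ‖x‖ ^ 2) ∂(ν : Measure (EuclideanSpace ℝ (Fin d))), ?_,
    fun k => ⟨?_, ?_⟩⟩
  · have := integral_mono (μ := (ν : Measure (EuclideanSpace ℝ (Fin d)))) (integrable_const (1 : ℝ))
      hi fun x => Real.one_le_exp (by positivity)
    simpa using this
  · refine (hi.mul_const (k.factorial * α⁻¹ ^ k)).mono' (by fun_prop) (ae_of_all _ fun x => ?_)
    rw [Real.norm_of_nonneg (by positivity)]
    exact hle k x
  · rw [mul_assoc, ← integral_mul_const]
    refine integral_mono_of_nonneg (ae_of_all _ fun x => by positivity)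
      (hi.mul_const _) (ae_of_all _ fun x => hle k x)

/-- Expand the exponential and integrate term by term by Tonelli; the factorials cancel and a
geometric series of ratio αL remains. -/
theorem sqExpMoment_le_of_pow_moments {ν : ProbabilityMeasure (EuclideanSpace ℝ (Fin d))}
    {D L α : ℝ} (hD : 0 ≤ D) (hL : 0 ≤ L) (hα : 0 ≤ α) (hαL : α * L < 1)
    (h : ∀ k : ℕ, Integrable (fun x => (‖x‖ ^ 2) ^ k)
        (ν : Measure (EuclideanSpace ℝ (Fin d))) ∧
      ∫ x, (‖x‖ ^ 2) ^ k ∂(ν : Measure (EuclideanSpace ℝ (Fin d))) ≤ D * k.factorial * L ^ k) :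
    sqExpMoment α ν ≤ ENNReal.ofReal (D * (1 - α * L)⁻¹) := by
  have hexp : ∀ x : EuclideanSpace ℝ (Fin d), ENNReal.ofReal (Real.exp (α * ‖x‖ ^ 2))
      = ∑' k : ℕ, ENNReal.ofReal (α ^ k / k.factorial * (‖x‖ ^ 2) ^ k) := by
    intro x
    have hs := NormedSpace.expSeries_div_hasSum_exp (𝔸 := ℝ) (α * ‖x‖ ^ 2)
    rw [← Real.exp_eq_exp_ℝ] at hs
    have hs' : HasSum (fun k : ℕ => α ^ k / k.factorial * (‖x‖ ^ 2) ^ k)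
        (Real.exp (α * ‖x‖ ^ 2)) := by
      have hfun : (fun k : ℕ => α ^ k / k.factorial * (‖x‖ ^ 2) ^ k)
          = fun k : ℕ => (α * ‖x‖ ^ 2) ^ k / k.factorial := by
        funext k
        rw [mul_pow]
        ring
      rw [hfun]
      exact hs
    rw [← hs'.tsum_eq, ENNReal.ofReal_tsum_of_nonneg (fun k => by positivity) hs'.summable]
  unfold sqExpMoment
  simp only [hexp]
  rw [lintegral_tsum fun k => by fun_prop]
  have hgeom := (hasSum_geometric_of_lt_one (mul_nonneg hα hL) hαL).mul_left D
  rw [← hgeom.tsum_eq, ENNReal.ofReal_tsum_of_nonneg (fun k => by positivity) hgeom.summable]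
  refine ENNReal.tsum_le_tsum fun k => ?_
  rw [← ofReal_integral_eq_lintegral_ofReal ((h k).1.const_mul _)
    (ae_of_all _ fun x => by positivity), integral_const_mul]
  refine ENNReal.ofReal_le_ofReal ?_
  calc α ^ k / k.factorial * ∫ x, (‖x‖ ^ 2) ^ k ∂(ν : Measure (EuclideanSpace ℝ (Fin d)))
      ≤ α ^ k / k.factorial * (D * k.factorial * L ^ k) :=
        mul_le_mul_of_nonneg_left (h k).2 (by positivity)
    _ = D * (α * L) ^ k := by
        rw [mul_pow]; field_simp

end SquareExponential

/-! ### Sharp second moment bound and time-uniform even moments. -/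

theorem integral_exp_eq_expQuotient (a t : ℝ) :
    ∫ s in (0 : ℝ)..t, Real.exp (a * s) = expQuotient a t := by
  unfold expQuotient
  split_ifs with h
  · simp [h]
  · rw [intervalIntegral.integral_comp_mul_left _ h, integral_exp, mul_zero, Real.exp_zero,
      smul_eq_mul, ← div_eq_inv_mul]

/-- Allows a negative η in place of γ even when γ ≥ 0; the strict sign is what absorbs the linear
term in the mean. -/
theorem AdmissiblePotentials.of_le {d : ℕ} {V W : EuclideanSpace ℝ (Fin d) → ℝ} {β γ γ' η : ℝ}
    (h : AdmissiblePotentials V W β γ γ') (hη : η ≤ γ) : AdmissiblePotentials V W β η γ' :=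
  { h with
    le_hessian_W := fun x v =>
      (mul_le_mul_of_nonneg_right hη (sq_nonneg _)).trans (h.le_hessian_W x v) }

section Moments

variable {d : ℕ} {V W : EuclideanSpace ℝ (Fin d) → ℝ} {β γ γ' : ℝ}
  {μ : ℝ → ProbabilityMeasure (EuclideanSpace ℝ (Fin d))}
  (hVW : AdmissiblePotentials V W β γ γ') (hμ : IsMcKeanVlasovSolution V W μ)
include hVW

theorem AdmissiblePotentials.integral_radialGenerator_le {η : ℝ} (hη : η < 0) (hηγ : η ≤ γ)
    {ν : Measure (EuclideanSpace ℝ (Fin d))} [IsProbabilityMeasure ν]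
    (hν : Integrable (fun y => ‖y‖ ^ 2) ν) (hν1 : Integrable (fun y => ‖y‖) ν)
    (hG : Integrable (fun x => ⟪x, gradConv W ν x⟫_ℝ) ν) :
    2 * (β + η) * (∫ x, ‖x‖ ^ 2 ∂ν) + ∫ x, (2 * d - 2 * β * ‖x‖ ^ 2 - 2 * ⟪x, (∇ V) 0⟫_ℝ
        - 2 * ⟪x, gradConv W ν x⟫_ℝ) ∂ν
      ≤ 2 * d + ‖(∇ V) 0‖ ^ 2 / (2 * |η|) := by
  have hid : Integrable (fun y => y) ν := (integrable_norm_iff (by fun_prop)).1 hν1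
  have hin : Integrable (fun x => ⟪x, (∇ V) 0⟫_ℝ) ν := hid.inner_const _
  have h1 := (hVW.of_le hηγ).integral_inner_gradConv_ge hν
  have e0 : Integrable (fun x : EuclideanSpace ℝ (Fin d) => 2 * d - 2 * β * ‖x‖ ^ 2) ν :=
    (integrable_const _).sub (hν.const_mul _)
  have e1 : Integrable (fun x : EuclideanSpace ℝ (Fin d) =>
      2 * d - 2 * β * ‖x‖ ^ 2 - 2 * ⟪x, (∇ V) 0⟫_ℝ) ν := e0.sub (hin.const_mul _)
  have e2 : ∫ x, ⟪x, (∇ V) 0⟫_ℝ ∂ν = ⟪∫ x, x ∂ν, (∇ V) 0⟫_ℝ := by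
    have := integral_inner (𝕜 := ℝ) hid ((∇ V) 0)
    simp only [real_inner_comm] at this ⊢
    exact this
  have e3 : ∫ x : EuclideanSpace ℝ (Fin d), (2 * (d : ℝ) - 2 * β * ‖x‖ ^ 2) ∂ν
      = 2 * d - 2 * β * ∫ x, ‖x‖ ^ 2 ∂ν := by
    rw [integral_sub (integrable_const _) (hν.const_mul _)]
    simp only [integral_const, probReal_univ, one_smul]
    exact congrArg _ (integral_const_mul _ _)
  rw [integral_sub e1 (hG.const_mul _), integral_sub e0 (hin.const_mul _), e3,
    integral_const_mul, integral_const_mul, e2]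
  set v := ∫ x, x ∂ν
  have h2 := (abs_le.1 (abs_real_inner_le_norm v ((∇ V) 0))).1
  rw [abs_of_neg hη]
  -- Completing the square in ‖v‖, the norm of the mean; this is the origin of the second term of G.
  have h3 : 2 * (‖v‖ * ‖(∇ V) 0‖) ≤ -2 * η * ‖v‖ ^ 2 + ‖(∇ V) 0‖ ^ 2 / (2 * -η) := by
    have hη' : 0 < -η := neg_pos.2 hη
    have h5 : -2 * η * ‖v‖ ^ 2 + ‖(∇ V) 0‖ ^ 2 / (2 * -η) - 2 * (‖v‖ * ‖(∇ V) 0‖)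
        = (2 * -η * ‖v‖ - ‖(∇ V) 0‖) ^ 2 / (2 * -η) := by
      rw [eq_div_iff (by positivity), sub_mul, add_mul, div_mul_cancel₀ _ (by positivity)]
      ring
    have h6 : 0 ≤ (2 * -η * ‖v‖ - ‖(∇ V) 0‖) ^ 2 / (2 * -η) := by positivity
    linarith
  linarith

include hμ

/-- A crude bound from the power step with j = 0 first supplies the domination; the exact inequality
then applies with weight ρ = 1 and rate 2(β + η), whatever its sign. -/
theorem second_moment_bound {η : ℝ} (hη : η < 0) (hηγ : η ≤ γ)
    (hinit : Integrable (fun x => ‖x‖ ^ 2) (μ 0 : Measure (EuclideanSpace ℝ (Fin d))))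
    {t : ℝ} (ht : 0 ≤ t) :
    Integrable (fun x => ‖x‖ ^ 2) (μ t : Measure (EuclideanSpace ℝ (Fin d))) ∧
    Real.exp (2 * (β + η) * t) * ∫ x, ‖x‖ ^ 2 ∂(μ t : Measure (EuclideanSpace ℝ (Fin d)))
      ≤ ∫ x, ‖x‖ ^ 2 ∂(μ 0 : Measure (EuclideanSpace ℝ (Fin d)))
        + (2 * d + ‖(∇ V) 0‖ ^ 2 / (2 * |η|)) * expQuotient (2 * (β + η)) t := by
  set K := max |γ| |γ'| with hK
  have hK0 : 0 ≤ K := le_max_of_le_left (abs_nonneg _)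
  obtain ⟨m, -, hmono, hm⟩ := exists_bound_first_moment hVW hμ hinit
  have hm' : ∀ s ∈ Icc 0 t, ∫ x, ‖x‖ ∂(μ s : Measure (EuclideanSpace ℝ (Fin d))) ≤ m t :=
    fun s hs => (hm s hs.1).2.trans (hmono hs.1 ht hs.2)
  have hmt : 0 ≤ m t := (integral_nonneg fun x => norm_nonneg x).trans (hm t ht).2
  -- Chosen so that κ ≥ 0 and δ - (β + γ) ≤ κ with δ = 1.
  set κ := |β + γ| + 1 with hκ
  have hκ0 : 0 ≤ κ := by positivity
  set C := (d : ℝ) + 2 + (‖(∇ V) 0‖ + K * m t) ^ 2 / (4 * 1) with hC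
  have hC0 : 0 ≤ C := by positivity
  set e₀ := ∫ x, ‖x‖ ^ 2 ∂(μ 0 : Measure (EuclideanSpace ℝ (Fin d))) with he₀
  have he₀0 : 0 ≤ e₀ := integral_nonneg fun x => sq_nonneg _
  have hapriori : ∀ s ∈ Icc 0 t,
      Integrable (fun x => ‖x‖ ^ 2) (μ s : Measure (EuclideanSpace ℝ (Fin d))) ∧
      ∫ x, ‖x‖ ^ 2 ∂(μ s : Measure (EuclideanSpace ℝ (Fin d)))
        ≤ Real.exp (2 * κ * t) * (e₀ + 2 * C * t) := by
    intro s hs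
    have h := pow_moment_step hVW hμ (m := m t) hs.1 one_pos hκ0
      (by have := neg_abs_le (β + γ); linarith)
      (fun u hu => hm' u ⟨hu.1.le, hu.2.trans hs.2⟩) 0 (Y := fun _ => 1) continuous_const
      (fun u _ => by simp) (by simpa using hinit)
    simp only [zero_add, pow_one, Nat.cast_zero, mul_one, one_pow] at h
    refine ⟨h.1, ?_⟩
    have h1 : ∫ u in (0 : ℝ)..s, Real.exp (-(2 * κ) * u) * (2 * C)
        ≤ ∫ u in (0 : ℝ)..s, 2 * C := by
      refine intervalIntegral.integral_mono_on hs.1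
        ((by fun_prop : Continuous _).intervalIntegrable _ _) intervalIntegrable_const
        fun u hu => mul_le_of_le_one_left (by positivity) (Real.exp_le_one_iff.2 ?_)
      have : 0 ≤ κ * u := mul_nonneg hκ0 hu.1
      linarith
    have h2 : Real.exp (-(2 * κ) * s) *
        ∫ x, ‖x‖ ^ 2 ∂(μ s : Measure (EuclideanSpace ℝ (Fin d))) ≤ e₀ + 2 * C * t := by
      have h3 := h.2
      simp only [mul_one] at hC
      rw [← hC] at h3
      simp only [intervalIntegral.integral_const, sub_zero, smul_eq_mul] at h1
      have h4 : s * (2 * C) ≤ t * (2 * C) := mul_le_mul_of_nonneg_right hs.2 (by positivity)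
      linarith
    rw [neg_mul, Real.exp_neg, inv_mul_le_iff₀ (Real.exp_pos _)] at h2
    refine h2.trans (mul_le_mul_of_nonneg_right (Real.exp_le_exp.2 ?_) (by positivity))
    exact mul_le_mul_of_nonneg_left hs.2 (by positivity)
  refine ⟨(hapriori t ⟨ht, le_rfl⟩).1, ?_⟩
  set A := 1 + 2 * d + 2 * |β| + 2 * ‖(∇ V) 0‖ + 2 * K * (1 + m t) with hA
  have hA0 : 1 ≤ A := by
    have : 0 ≤ 2 * (d : ℝ) + 2 * |β| + 2 * ‖(∇ V) 0‖ + 2 * K * (1 + m t) := by positivity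
    linarith
  have hdom := lyapunov_dominated hVW hμ (ρ := fun _ => 1) contDiff_const (fun _ _ => zero_le_one)
    (lam := 2 * (β + η)) (S := A * (1 + Real.exp (2 * κ * t) * (e₀ + 2 * C * t))) ht
    (H := fun _ => 2 * d + ‖(∇ V) 0‖ ^ 2 / (2 * |η|)) intervalIntegrable_const
    (f := fun x => A * (1 + ‖x‖ ^ 2)) (by fun_prop)
    (fun x => by
      simp only [intervalIntegral.integral_const, sub_zero, smul_eq_mul, mul_one]
      nlinarith [sq_nonneg ‖x‖])
    (fun s hs => ((integrable_const _).add (hapriori s hs).1).const_mul _)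
    (fun s hs => by
      rw [integral_const_mul, integral_add (integrable_const _) (hapriori s hs).1]
      refine mul_le_mul_of_nonneg_left ?_ (zero_le_one.trans hA0)
      simpa using (hapriori s hs).2)
    (by
      filter_upwards [ae_restrict_mem measurableSet_Ioc] with s hs hs1
      have hs' : s ∈ Icc 0 t := ⟨hs.1.le, hs.2⟩
      have hgc := hVW.continuous_gradConv hs1
      have hGb : ∀ x, |⟪x, gradConv W (μ s : Measure (EuclideanSpace ℝ (Fin d))) x⟫_ℝ|
          ≤ K * (1 + m t) * (1 + ‖x‖ ^ 2) := fun x => by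
        refine (abs_real_inner_le_norm _ _).trans ?_
        have h1 := hVW.norm_gradConv_le hs1 x
        have h2 : K * (‖x‖ + ∫ y, ‖y‖ ∂(μ s : Measure (EuclideanSpace ℝ (Fin d))))
            ≤ K * (‖x‖ + m t) := by
          have := hm' s hs'
          gcongr
        have h3 : ‖x‖ * (‖x‖ + m t) ≤ (1 + m t) * (1 + ‖x‖ ^ 2) := by
          nlinarith [mul_nonneg hmt (sq_nonneg (‖x‖ - 1)), mul_nonneg hmt (norm_nonneg x)]
        calc ‖x‖ * ‖gradConv W (μ s : Measure (EuclideanSpace ℝ (Fin d))) x‖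
            ≤ ‖x‖ * (K * (‖x‖ + m t)) :=
              mul_le_mul_of_nonneg_left (h1.trans h2) (norm_nonneg _)
          _ = K * (‖x‖ * (‖x‖ + m t)) := by ring
          _ ≤ K * ((1 + m t) * (1 + ‖x‖ ^ 2)) := mul_le_mul_of_nonneg_left h3 hK0
          _ = _ := by ring
      have hxg : Continuous fun x =>
          ⟪x, gradConv W (μ s : Measure (EuclideanSpace ℝ (Fin d))) x⟫_ℝ :=
        continuous_id.inner hgc
      -- The majorant replaces ⟨x, ∇V(x)⟩ by its lower bound, so it grows at most quadratically and
      -- is dominated by f. The interaction is kept intact, since symmetrisation needs its integral.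
      refine ⟨fun x => 2 * d - 2 * β * ‖x‖ ^ 2 - 2 * ⟪x, (∇ V) 0⟫_ℝ
        - 2 * ⟪x, gradConv W (μ s : Measure (EuclideanSpace ℝ (Fin d))) x⟫_ℝ,
        by fun_prop, fun x => ?_, fun x => ?_, ?_⟩
      · have h1 := abs_le.1 (hGb x)
        have h2 := abs_le.1 (abs_real_inner_le_norm x ((∇ V) 0))
        have h3 : ‖x‖ * ‖(∇ V) 0‖ ≤ ‖(∇ V) 0‖ * (1 + ‖x‖ ^ 2) := by
          nlinarith [norm_nonneg ((∇ V) 0), sq_nonneg (‖x‖ - 1)]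
        have h4 := abs_le.1 (le_refl (|β|))
        have h5 := mul_le_mul_of_nonneg_right h4.1 (sq_nonneg ‖x‖)
        have h6 := mul_le_mul_of_nonneg_right h4.2 (sq_nonneg ‖x‖)
        have hd : (0 : ℝ) ≤ d * ‖x‖ ^ 2 := by positivity
        have hd' : (0 : ℝ) ≤ d := Nat.cast_nonneg d
        have hb := abs_nonneg β
        have hx2 := sq_nonneg ‖x‖
        rw [abs_le, hA]
        constructor <;> linarith
      · have h1 := hVW.inner_gradient_V_ge x
        simp only [radialGenerator, deriv_const, inner_add_right]
        linarith
      · simp only [intervalIntegral.integral_const, sub_zero, smul_eq_mul, mul_one]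
        refine hVW.integral_radialGenerator_le hη hηγ (hapriori s hs').1 hs1 ?_
        exact Integrable.mono' (((integrable_const 1).add (hapriori s hs').1).const_mul _)
          hxg.aestronglyMeasurable (ae_of_all _ hGb))
  simp only [intervalIntegral.integral_const, sub_zero, smul_eq_mul, mul_one,
    intervalIntegral.integral_mul_const, integral_exp_eq_expQuotient] at hdom
  rw [mul_comm (expQuotient _ _)] at hdom
  exact hdom

/-- With c = (β + γ)/2, half of the convexity pays for the linear terms and the other half damps the
moment of order j + 1 at rate 2(j+1)c. The ratio of source to damping is (j+1)C/c times the previous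
moment, whence k! and L = max(l, C/c). -/
theorem pow_moments_uniform_bound (hpos : 0 < β + γ) {m D l C : ℝ} (hl : 0 ≤ l) (hD : 1 ≤ D)
    (hm : ∀ s, 0 ≤ s → ∫ x, ‖x‖ ∂(μ s : Measure (EuclideanSpace ℝ (Fin d))) ≤ m)
    (hC : C = d + 2 + (‖(∇ V) 0‖ + max |γ| |γ'| * m) ^ 2 / (4 * ((β + γ) / 2)))
    (hinit : ∀ k : ℕ, Integrable (fun x => (‖x‖ ^ 2) ^ k)
        (μ 0 : Measure (EuclideanSpace ℝ (Fin d))) ∧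
      ∫ x, (‖x‖ ^ 2) ^ k ∂(μ 0 : Measure (EuclideanSpace ℝ (Fin d))) ≤ D * k.factorial * l ^ k)
    (k : ℕ) : ∀ t, 0 ≤ t → Integrable (fun x => (‖x‖ ^ 2) ^ k)
        (μ t : Measure (EuclideanSpace ℝ (Fin d))) ∧
      ∫ x, (‖x‖ ^ 2) ^ k ∂(μ t : Measure (EuclideanSpace ℝ (Fin d)))
        ≤ D * k.factorial * (max l (C / ((β + γ) / 2))) ^ k := by
  set c := (β + γ) / 2 with hc
  have hc0 : 0 < c := half_pos hpos
  have hcc : β + γ = 2 * c := by rw [hc]; ring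
  set L := max l (C / c) with hL
  have hL0 : 0 ≤ L := le_max_of_le_left hl
  have hC0 : 0 ≤ C := by rw [hC]; positivity
  have hK0 : 0 ≤ max |γ| |γ'| := le_max_of_le_left (abs_nonneg _)
  -- Bounds on [0, t] with κ = 0, admissible as c ≤ β + γ. They depend on t and serve only to
  -- justify domination.
  have hloc : ∀ (k : ℕ) (t s : ℝ), s ∈ Icc 0 t → Integrable (fun x => (‖x‖ ^ 2) ^ k)
        (μ s : Measure (EuclideanSpace ℝ (Fin d))) ∧
      ∫ x, (‖x‖ ^ 2) ^ k ∂(μ s : Measure (EuclideanSpace ℝ (Fin d)))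
        ≤ D * k.factorial * (l + 2 * C * t) ^ k := by
    intro k t s hs
    have h := pow_moments_bound hVW hμ hc0 le_rfl hl hD (by linarith)
      (fun u hu => hm u hu.1.le) hC hinit k s hs
    refine ⟨h.1, h.2.trans ?_⟩
    have hs0 := hs.1
    have hst := hs.2
    simp only [mul_zero, zero_mul, Real.exp_zero, one_mul]
    gcongr
  induction k with
  | zero => intro t _; simpa using hD
  | succ j ih =>
    intro t ht
    refine ⟨(hloc (j + 1) t t ⟨ht, le_rfl⟩).1, ?_⟩
    set lam : ℝ := 2 * (j + 1) * c with hlam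
    have hlam0 : 0 < lam := by positivity
    set h : ℝ := 2 * (j + 1) ^ 2 * C * (D * j.factorial * L ^ j) with hh
    have hint : ∀ (A B : ℝ) s, s ∈ Icc 0 t → Integrable (fun x : EuclideanSpace ℝ (Fin d) =>
        A * (‖x‖ ^ 2) ^ (j + 1) + B * (‖x‖ ^ 2) ^ j)
        (μ s : Measure (EuclideanSpace ℝ (Fin d))) ∧
        ∫ x, (A * (‖x‖ ^ 2) ^ (j + 1) + B * (‖x‖ ^ 2) ^ j)
          ∂(μ s : Measure (EuclideanSpace ℝ (Fin d)))
        = A * (∫ x, (‖x‖ ^ 2) ^ (j + 1) ∂(μ s : Measure (EuclideanSpace ℝ (Fin d))))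
          + B * ∫ x, (‖x‖ ^ 2) ^ j ∂(μ s : Measure (EuclideanSpace ℝ (Fin d))) := by
      intro A B s hs
      have h1 := ((hloc (j + 1) t s hs).1).const_mul A
      have h2 := ((hloc j t s hs).1).const_mul B
      exact ⟨h1.add h2, by rw [integral_add h1 h2, integral_const_mul, integral_const_mul]⟩
    have hdom := lyapunov_dominated hVW hμ (contDiff_pow_weight j) (pow_weight_nonneg j)
      (lam := lam) (H := fun _ => h) ht intervalIntegrable_const
      (f := fun x => (lam + 1) * (‖x‖ ^ 2) ^ (j + 1) + 2 * (j + 1) ^ 2 * C * (‖x‖ ^ 2) ^ j)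
      (S := (lam + 1) * (D * (j + 1).factorial * (l + 2 * C * t) ^ (j + 1))
        + 2 * (j + 1) ^ 2 * C * (D * j.factorial * (l + 2 * C * t) ^ j)) (by fun_prop)
      (fun x => by
        rw [integral_pow_weight]
        have h1 : 0 ≤ lam * (‖x‖ ^ 2) ^ (j + 1) := by positivity
        have h2 : 0 ≤ 2 * ((j : ℝ) + 1) ^ 2 * C * (‖x‖ ^ 2) ^ j := by positivity
        linarith)
      (fun s hs => (hint _ _ s hs).1)
      (fun s hs => by
        rw [(hint _ _ s hs).2]
        have h1 := (hloc (j + 1) t s hs).2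
        have h2 := (hloc j t s hs).2
        gcongr)
      (by
        filter_upwards [ae_restrict_mem measurableSet_Ioc] with s hs hs1
        have hs' : s ∈ Icc 0 t := ⟨hs.1.le, hs.2⟩
        refine ⟨fun x => -lam * (‖x‖ ^ 2) ^ (j + 1) + 2 * (j + 1) ^ 2 * C * (‖x‖ ^ 2) ^ j,
          by fun_prop, fun x => ?_, fun x => ?_, ?_⟩
        · have h1 : 0 ≤ lam * (‖x‖ ^ 2) ^ (j + 1) := by positivity
          have h2 : 0 ≤ 2 * ((j : ℝ) + 1) ^ 2 * C * (‖x‖ ^ 2) ^ j := by positivity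
          have h3 : 0 ≤ (‖x‖ ^ 2) ^ (j + 1) := by positivity
          rw [abs_le]
          constructor <;> linarith
        · have := hVW.radialGenerator_pow_le hs1 (κ := -c) (add_le_add_right
            (mul_le_mul_of_nonneg_left (hm s hs'.1) hK0) _) hc0 (by linarith) j x
          rw [← hC] at this
          linarith
        · simp only [integral_pow_weight]
          rw [(hint _ _ s hs').2]
          have h1 := mul_le_mul_of_nonneg_left (ih s hs'.1).2
            (show 0 ≤ 2 * ((j : ℝ) + 1) ^ 2 * C by positivity)
          linarith)
    simp only [integral_pow_weight, intervalIntegral.integral_mul_const,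
      integral_exp_eq_expQuotient, expQuotient, if_neg hlam0.ne'] at hdom
    -- The level Z is a barrier: it bounds the initial moment and satisfies h ≤ lam Z, so the right
    -- side is at most Z + (e^{lam t} - 1) Z.
    set Z := D * (j + 1).factorial * L ^ (j + 1) with hZ
    have hZ1 : ∫ x, (‖x‖ ^ 2) ^ (j + 1) ∂(μ 0 : Measure (EuclideanSpace ℝ (Fin d))) ≤ Z := by
      refine (hinit (j + 1)).2.trans ?_
      rw [hZ]
      have := le_max_left l (C / c)
      gcongr
    have hZ2 : h ≤ lam * Z := by
      have h1 : C ≤ c * L := by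
        have := le_max_right l (C / c)
        rwa [div_le_iff₀' hc0] at this
      have h2 : 0 ≤ 2 * ((j : ℝ) + 1) ^ 2 * (D * j.factorial * L ^ j) := by positivity
      have h3 := mul_le_mul_of_nonneg_left h1 h2
      rw [hh, hlam, hZ, Nat.factorial_succ]
      push_cast
      rw [pow_succ L j]
      linarith
    have he : 0 ≤ (Real.exp (lam * t) - 1) / lam :=
      div_nonneg (sub_nonneg.2 (Real.one_le_exp (by positivity))) hlam0.le
    have hfin : (Real.exp (lam * t) - 1) / lam * h ≤ (Real.exp (lam * t) - 1) * Z := by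
      refine (mul_le_mul_of_nonneg_left hZ2 he).trans_eq ?_
      field_simp
    have : Real.exp (lam * t) *
        ∫ x, (‖x‖ ^ 2) ^ (j + 1) ∂(μ t : Measure (EuclideanSpace ℝ (Fin d)))
        ≤ Real.exp (lam * t) * Z := by linarith
    exact le_of_mul_le_mul_left this (Real.exp_pos _)

end Moments

/-! ### Assembly of the three assertions. -/

section MainTheorem

variable {d : ℕ} {V W : EuclideanSpace ℝ (Fin d) → ℝ} {β γ γ' : ℝ}
  {μ : ℝ → ProbabilityMeasure (EuclideanSpace ℝ (Fin d))}
  (hVW : AdmissiblePotentials V W β γ γ') (hμ : IsMcKeanVlasovSolution V W μ)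
include hVW hμ

theorem secondMoment_le {η : ℝ} (hη : η < 0) (hηγ : η ≤ γ) {t : ℝ} (ht : 0 ≤ t) :
    secondMoment (μ t) ≤ ENNReal.ofReal (Real.exp (-(2 * (β + η) * t))) *
      (secondMoment (μ 0) + ENNReal.ofReal
        ((2 * d + ‖(∇ V) 0‖ ^ 2 / (2 * |η|)) * expQuotient (2 * (β + η)) t)) := by
  by_cases h0 : secondMoment (μ 0) < ⊤
  · have hinit := (integrable_norm_sq_iff _).2 h0
    obtain ⟨hi, hle⟩ := second_moment_bound hVW hμ hη hηγ hinit ht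
    have hq : 0 ≤ expQuotient (2 * (β + η)) t := by
      rw [← integral_exp_eq_expQuotient]
      exact intervalIntegral.integral_nonneg ht fun _ _ => (Real.exp_pos _).le
    rw [secondMoment_eq_ofReal hi, secondMoment_eq_ofReal hinit,
      ← ENNReal.ofReal_add (integral_nonneg fun x => sq_nonneg _) (by positivity),
      ← ENNReal.ofReal_mul (Real.exp_pos _).le]
    refine ENNReal.ofReal_le_ofReal ?_
    rwa [Real.exp_neg, le_inv_mul_iff₀ (Real.exp_pos _)]
  · rw [not_lt_top_iff.1 h0, top_add, ENNReal.mul_top]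
    · exact le_top
    · simpa using Real.exp_pos _

theorem exists_bound_second_moment (hβ : 0 < β) (hβγ : 0 < β + γ)
    (hinit : Integrable (fun x => ‖x‖ ^ 2) (μ 0 : Measure (EuclideanSpace ℝ (Fin d)))) :
    ∃ S : ℝ, ∀ t, 0 ≤ t →
      Integrable (fun x => ‖x‖ ^ 2) (μ t : Measure (EuclideanSpace ℝ (Fin d))) ∧
      ∫ x, ‖x‖ ^ 2 ∂(μ t : Measure (EuclideanSpace ℝ (Fin d))) ≤ S := by
  -- A negative η ≤ γ with β + η > 0: γ itself if negative, otherwise -β/2, which is where β > 0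
  -- enters.
  obtain ⟨η, hη, hηγ, ha⟩ : ∃ η : ℝ, η < 0 ∧ η ≤ γ ∧ 0 < 2 * (β + η) := by
    rcases lt_or_ge γ 0 with h | h
    · exact ⟨γ, h, le_rfl, by linarith⟩
    · exact ⟨-β / 2, by linarith, by linarith, by linarith⟩
  set a := 2 * (β + η)
  set G := 2 * (d : ℝ) + ‖(∇ V) 0‖ ^ 2 / (2 * |η|) with hG
  have hG0 : 0 ≤ G := by positivity
  set e₀ := ∫ x, ‖x‖ ^ 2 ∂(μ 0 : Measure (EuclideanSpace ℝ (Fin d))) with he₀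
  have he₀0 : 0 ≤ e₀ := integral_nonneg fun x => sq_nonneg _
  refine ⟨e₀ + G / a, fun t ht => ?_⟩
  obtain ⟨hi, hle⟩ := second_moment_bound hVW hμ hη hηγ hinit ht
  refine ⟨hi, ?_⟩
  rw [expQuotient, if_neg ha.ne'] at hle
  have h1 : 1 ≤ Real.exp (a * t) := Real.one_le_exp (by positivity)
  have h2 : G * ((Real.exp (a * t) - 1) / a) ≤ Real.exp (a * t) * (G / a) := by
    have : 0 ≤ G / a := by positivity
    have e : G * ((Real.exp (a * t) - 1) / a) = Real.exp (a * t) * (G / a) - G / a := by ring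
    linarith
  have h3 : e₀ ≤ Real.exp (a * t) * e₀ := le_mul_of_one_le_left he₀0 h1
  refine le_of_mul_le_mul_left (a := Real.exp (a * t)) ?_ (Real.exp_pos _)
  linarith

theorem exists_sqExpMoment_propagation {α₀ : ℝ} (hα₀ : 0 < α₀) :
    ∃ α : ℝ → ℝ, ContinuousOn α (Ici 0) ∧ (∀ t : ℝ, 0 ≤ t → 0 < α t) ∧ α 0 = α₀ ∧
      (sqExpMoment α₀ (μ 0) < ⊤ → ∀ t : ℝ, 0 ≤ t → sqExpMoment (α t) (μ t) < ⊤) := by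
  by_cases h0 : sqExpMoment α₀ (μ 0) < ⊤
  swap
  -- With an infinite initial moment the required implication is vacuous.
  · exact ⟨fun _ => α₀, continuousOn_const, fun _ _ => hα₀, rfl, fun h => absurd h h0⟩
  obtain ⟨D, hD, hinit⟩ := exists_pow_moments_bound_of_sqExpMoment hα₀ h0
  obtain ⟨m, hmc, hmono, hm⟩ := exists_bound_first_moment hVW hμ (by simpa using (hinit 1).1)
  set K := max |γ| |γ'| with hK
  set κ := |β + γ| + 1 with hκ
  have hκ0 : 0 ≤ κ := by positivity
  set C : ℝ → ℝ := fun t => (d : ℝ) + 2 + (‖(∇ V) 0‖ + K * m t) ^ 2 / (4 * 1) with hC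
  have hC0 : ∀ t, 0 ≤ C t := fun t => by positivity
  have hCc : ContinuousOn C (Ici 0) := by fun_prop (disch := norm_num)
  set L : ℝ → ℝ := fun t => Real.exp (2 * κ * t) * (α₀⁻¹ + 2 * C t * t) with hL
  have hLc : ContinuousOn L (Ici 0) := by fun_prop
  have hLpos : ∀ t, 0 ≤ t → 0 < L t := fun t ht => by
    have := hC0 t
    positivity
  have hpos : ∀ t, 0 ≤ t → 0 < L t * (1 + t) := fun t ht => mul_pos (hLpos t ht) (by linarith)
  -- Since L(0) = 1/α₀, this equals α₀ at time 0; the factor 1 + t makes α(t)L(t) < 1 strictly for t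
  -- > 0, as the geometric series requires. Time 0 is the hypothesis itself.
  refine ⟨fun t => (L t * (1 + t))⁻¹, ?_, fun t ht => inv_pos.2 (hpos t ht), by simp [hL], ?_⟩
  · exact (hLc.mul (by fun_prop)).inv₀ fun t ht => (hpos t ht).ne'
  · intro _ t ht
    rcases ht.eq_or_lt with rfl | ht'
    · simpa [hL] using h0
    have hb : ∀ k : ℕ, _ := fun k => pow_moments_bound hVW hμ (T := t) (m := m t) one_pos hκ0
      (inv_pos.2 hα₀).le hD (by have := neg_abs_le (β + γ); linarith)
      (fun s hs => (hm s hs.1.le).2.trans (hmono (mem_Ici.2 hs.1.le) ht hs.2)) rfl hinit k t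
      ⟨ht, le_rfl⟩
    have hlt : (L t * (1 + t))⁻¹ * L t < 1 := by
      rw [mul_inv, mul_right_comm, inv_mul_cancel₀ (hLpos t ht).ne', one_mul]
      exact inv_lt_one_of_one_lt₀ (by linarith)
    exact (sqExpMoment_le_of_pow_moments (zero_le_one.trans hD) (hLpos t ht).le
      (inv_pos.2 (hpos t ht)).le hlt hb).trans_lt ENNReal.ofReal_lt_top

theorem exists_uniform_sqExpMoment_bound (hβ : 0 < β) (hβγ : 0 < β + γ) {α₀ : ℝ} (hα₀ : 0 < α₀)
    (h0 : sqExpMoment α₀ (μ 0) < ⊤) :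
    ∃ α : ℝ, 0 < α ∧ (⨆ (t : ℝ) (_ : 0 ≤ t), sqExpMoment α (μ t)) < ⊤ := by
  obtain ⟨D, hD, hinit⟩ := exists_pow_moments_bound_of_sqExpMoment hα₀ h0
  obtain ⟨S, hS⟩ := exists_bound_second_moment hVW hμ hβ hβγ (by simpa using (hinit 1).1)
  have hm : ∀ s, 0 ≤ s → ∫ x, ‖x‖ ∂(μ s : Measure (EuclideanSpace ℝ (Fin d))) ≤ 1 + S := by
    intro s hs
    have hi : Integrable (fun x => 1 + ‖x‖ ^ 2) (μ s : Measure (EuclideanSpace ℝ (Fin d))) :=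
      (integrable_const _).add (hS s hs).1
    refine (integral_mono_of_nonneg (ae_of_all _ fun x => norm_nonneg x) hi
      (ae_of_all _ fun x => ?_)).trans ?_
    · simp only
      nlinarith [sq_nonneg (‖x‖ - 1), sq_nonneg ‖x‖]
    · rw [integral_add (integrable_const _) (hS s hs).1]
      simpa using (hS s hs).2
  have hb := pow_moments_uniform_bound hVW hμ hβγ (inv_pos.2 hα₀).le hD hm rfl hinit
  set L := max α₀⁻¹ (((d : ℝ) + 2 + (‖(∇ V) 0‖ + max |γ| |γ'| * (1 + S)) ^ 2
    / (4 * ((β + γ) / 2))) / ((β + γ) / 2))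
  have hL : 0 < L := lt_max_of_lt_left (inv_pos.2 hα₀)
  have hlt : (2 * L)⁻¹ * L < 1 := by
    rw [mul_inv, mul_assoc, inv_mul_cancel₀ hL.ne']
    norm_num
  -- Any exponent below 1/L works; this one gives ratio 1/2 in the geometric series.
  refine ⟨(2 * L)⁻¹, by positivity, lt_of_le_of_lt (iSup₂_le fun t ht => ?_)
    (ENNReal.ofReal_lt_top (r := D * (1 - (2 * L)⁻¹ * L)⁻¹))⟩
  exact sqExpMoment_le_of_pow_moments (zero_le_one.trans hD) hL.le (by positivity) hlt
    fun k => hb k t ht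

end MainTheorem

theorem mainTheorem11 {d : ℕ} (V W : EuclideanSpace ℝ (Fin d) → ℝ) (β γ γ' : ℝ)
    (hVW : AdmissiblePotentials V W β γ γ')
    (μ : ℝ → ProbabilityMeasure (EuclideanSpace ℝ (Fin d)))
    (hμ : IsMcKeanVlasovSolution V W μ) :
    -- (i) the bound on the second moment
    (∀ η : ℝ, η < 0 → (γ < 0 → η = γ) →
      ∀ a G : ℝ, a = 2 * (β + η) → G = 2 * (d : ℝ) + ‖(∇ V) 0‖ ^ 2 / (2 * |η|) →
        ∀ t : ℝ, 0 ≤ t →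
          secondMoment (μ t) ≤
            ENNReal.ofReal (Real.exp (-(a * t))) *
              (secondMoment (μ 0) + ENNReal.ofReal (G * expQuotient a t))) ∧
    -- (ii) propagation of square-exponential moments
    (∀ α₀ : ℝ, 0 < α₀ →
      ∃ α : ℝ → ℝ, ContinuousOn α (Ici 0) ∧ (∀ t : ℝ, 0 ≤ t → 0 < α t) ∧ α 0 = α₀ ∧
        (sqExpMoment α₀ (μ 0) < ⊤ → ∀ t : ℝ, 0 ≤ t → sqExpMoment (α t) (μ t) < ⊤)) ∧
    -- (iii) uniform bounds in the uniformly convex case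
    (0 < β → 0 < β + γ →
      (secondMoment (μ 0) < ⊤ → (⨆ (t : ℝ) (_ : 0 ≤ t), secondMoment (μ t)) < ⊤) ∧
      ((∃ α₀ : ℝ, 0 < α₀ ∧ sqExpMoment α₀ (μ 0) < ⊤) →
        ∃ α : ℝ, 0 < α ∧ (⨆ (t : ℝ) (_ : 0 ≤ t), sqExpMoment α (μ t)) < ⊤)) := by
  refine ⟨?_, fun α₀ hα₀ => exists_sqExpMoment_propagation hVW hμ hα₀, fun hβ hβγ => ⟨?_, ?_⟩⟩
  · rintro η hη hγη a G rfl rfl t ht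
    refine secondMoment_le hVW hμ hη ?_ ht
    rcases lt_or_ge γ 0 with h | h
    · exact (hγη h).le
    · exact hη.le.trans h
  · intro h0
    obtain ⟨S, hS⟩ := exists_bound_second_moment hVW hμ hβ hβγ ((integrable_norm_sq_iff _).2 h0)
    refine lt_of_le_of_lt (iSup₂_le fun t ht => ?_) (ENNReal.ofReal_lt_top (r := S))
    rw [secondMoment_eq_ofReal (hS t ht).1]
    exact ENNReal.ofReal_le_ofReal (hS t ht).2
  · rintro ⟨α₀, hα₀, h0⟩
    exact exists_uniform_sqExpMoment_bound hVW hμ hβ hβγ hα₀ h0
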